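/- Let $b>0$ and let $p,q\in C^1([0,b],\mathbb C)$. Put $$B=\begin{pmatrix}0&1\\-1&0\end{pmatrix},\qquad Q(x)=\begin{pmatrix}p(x)&q(x)\\q(x)&-p(x)\end{pmatrix},\qquad U_0(\lambda,x)=\begin{pmatrix}\cos\lambda x&-\sin\lambda x\\ \sin\lambda x&\cos\lambda x\end{pmatrix}.$$ For every $\lambda\in\mathbb C$ let $U(\lambda,\cdot)$ denote the matrix solution on $[0,b]$ of the Dirac equation $B\,U'+Q(x)U=\lambda U$, $U(\lambda,0)=I$. Let $K$ be the transmutation kernel, i.e. a $2\times2$ matrix-valued function, continuously differentiable on $\Omega^+=\{(x,t):0\le x\le b,\ |t|\le x\}$, with $$BK_x(x,t)+K_t(x,t)B=-Q(x)K(x,t)\ \text{ on }\Omega^+,$$ $$BK(x,x)-K(x,x)B=-Q(x),\qquad BK(x,-x)+K(x,-x)B=0\qquad(0\le x\le b).$$ Let $$K_n(x)=\frac{2n+1}{2}\int_{-x}^{x}K(x,t)P_n(t/x)\,dt\qquad (n\ge0)$$ be the coefficients of its Fourier–Legendre expansion $K(x,t)=\sum_{n\ge0}\frac1xK_n(x)P_n(t/x)$,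 where $P_n$ are the Legendre polynomials (and $K_n(0)=0$), let $K_{-1}:=-K_0$, and let $\theta_n(x):=x^nK_n(x)$ for $n\ge-1$. Let $j_n$ be the spherical Bessel functions of the first kind, and let $$\mathcal S[H](x)=U(0,x)\int_0^xU(0,t)^{-1}B^{T}H(t)\,dt$$ be the solution operator of the inhomogeneous Dirac equation $BY'+QY=H$, $Y(0)=0$. Then such $U$ and $K$ exist, and for all such $U$ and $K$ the following hold. 1. For all $\lambda\in\mathbb C$ and $x\in[0,b]$, $$U(\lambda,x)=U_0(\lambda,x)+\int_{-x}^{x}K(x,t)U_0(\lambda,t)\,dt,$$ and, with convergent series, $$U(\lambda,x)=U_0(\lambda,x)+\sum_{n=0}^\infty\frac1xK_n(x)\int_{-x}^{x}U_0(\lambda,t)P_n(t/x)\,dt\qquad(x>0),$$ $$U(\lambda,x)=U_0(\lambda,x)+2\sum_{n=0}^\infty(-1)^nK_{2n}(x)\,j_{2n}(\lambda x)-2\sum_{n=0}^\infty(-1)^nK_{2n+1}(x)B\,j_{2n+1}(\lambda x).$$ 2. $U(0,x)$ is invertible for every $x\in[0,b]$, and $\theta_n$ is continuous on $[0,b]$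 for every $n\ge0$. The functions $\theta_n$ are given recursively by $$\theta_0(x)=K_0(x)=\tfrac12\bigl(U(0,x)-I\bigr)\quad(0\le x\le b),$$ $$\theta_{-1}(x)=-\tfrac1xK_0(x)=-\tfrac1{2x}\bigl(U(0,x)-I\bigr)\quad(0<x\le b),$$ and, for all $n\ge1$ and $0\le x\le b$ (the terms $x^2\theta_{-1}(x)$ and $x\theta_{-1}(x)$ being $0$ at $x=0$), $$\theta_n(x)=\frac{2n+1}{2n-3}\Bigl[x^2\theta_{n-2}(x)+\mathcal S\bigl[-(2n-1)\,x\,B\theta_{n-2}+(2n-3)\,\theta_{n-1}B\bigr](x)\Bigr].$$ -/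

import Mathlib

open MeasureTheory Set Filter Topology
open scoped Matrix Nat

-- A norm on the complex 2 × 2 matrices, needed for derivatives and integrals of matrix-valued
-- functions (all norms on this space are equivalent).
attribute [local instance] Matrix.linftyOpNormedRing Matrix.linftyOpNormedAlgebra

noncomputable section

namespace Dirac

/-- Complex `2 × 2` matrices. -/
abbrev M2 : Type := Matrix (Fin 2) (Fin 2) ℂ

/-- The matrix `B` of the one-dimensional Dirac equation. -/
def B : M2 := !![0, 1; -1, 0]

/-- The matrix potential in canonical form. -/
def potential (p q : ℝ → ℂ) (x : ℝ) : M2 := !![p x, q x; q x, -p x]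

/-- `U` is the matrix solution, for every complex `lam`, of
`B U' + Q(x) U = lam U` on `[0, b]` with `U(lam, 0) = I`. -/
def IsFundamentalSolution (b : ℝ) (Q : ℝ → M2) (U : ℂ → ℝ → M2) : Prop :=
  ∀ lam : ℂ, U lam 0 = 1 ∧ DifferentiableOn ℝ (U lam) (Icc 0 b) ∧
    ∀ x ∈ Icc (0 : ℝ) b,
      B * derivWithin (U lam) (Icc 0 b) x + Q x * U lam x = lam • U lam x

/-- The matrix solution `U₀` for the zero potential. -/
def U₀ (lam : ℂ) (x : ℝ) : M2 :=
  !![Complex.cos (lam * x), -Complex.sin (lam * x);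
     Complex.sin (lam * x), Complex.cos (lam * x)]

/-- The triangle `Ω⁺ = {(x, t) : 0 ≤ x ≤ b, |t| ≤ x}`. -/
def triangle (b : ℝ) : Set (ℝ × ℝ) := {z | 0 ≤ z.1 ∧ z.1 ≤ b ∧ |z.2| ≤ z.1}

/-- `K` is the kernel, on `Ω⁺`, of the Volterra transmutation operator
`T Y (x) = Y(x) + ∫_{-x}^{x} K(x,t) Y(t) dt` relating `B d/dx` and `B d/dx + Q`: a continuously
differentiable solution of the Goursat problem
`B K_x + K_t B = - Q K` on `Ω⁺`, `B K(x,x) - K(x,x) B = - Q(x)`, `B K(x,-x) + K(x,-x) B = 0`. -/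
structure IsTransmutationKernel (b : ℝ) (Q : ℝ → M2) (K : ℝ → ℝ → M2) : Prop where
  contDiffOn : ContDiffOn ℝ 1 (Function.uncurry K) (triangle b)
  pde : ∀ z ∈ triangle b,
    B * fderivWithin ℝ (Function.uncurry K) (triangle b) z (1, 0)
      + fderivWithin ℝ (Function.uncurry K) (triangle b) z (0, 1) * B = -(Q z.1 * K z.1 z.2)
  diag : ∀ x ∈ Icc (0 : ℝ) b, B * K x x - K x x * B = -Q x
  antidiag : ∀ x ∈ Icc (0 : ℝ) b, B * K x (-x) + K x (-x) * B = 0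

/-- The Legendre polynomial `P_n`, by the formula of Rodrigues. -/
def legendreP (n : ℕ) : Polynomial ℝ :=
  Polynomial.C (1 / (2 ^ n * (n ! : ℝ))) *
    Polynomial.derivative^[n] ((Polynomial.X ^ 2 - 1) ^ n)

/-- The spherical Bessel function of the first kind `j_n` (an entire function), by its power
series `j_n(z) = z^n ∑_k (-z²/2)^k / (k! (2n+2k+1)!!)`. -/
def sphBessel (n : ℕ) (z : ℂ) : ℂ :=
  z ^ n * ∑' k : ℕ, (-(z ^ 2) / 2) ^ k / ((k ! : ℂ) * ((2 * n + 2 * k + 1)‼ : ℂ))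

/-- The coefficients `K_n` of the Fourier–Legendre expansion
`K(x,t) = ∑_n (1/x) K_n(x) P_n(t/x)` of a kernel `K`. -/
def legendreCoeff (K : ℝ → ℝ → M2) (n : ℕ) (x : ℝ) : M2 :=
  ((2 * (n : ℝ) + 1) / 2) • ∫ t in (-x)..x, ((legendreP n).eval (t / x)) • K x t

/-- The coefficients extended by the convention `K_{-1} = -K_0`
(indices below `-1` are not used). -/
def legendreCoeffExt (K : ℝ → ℝ → M2) : ℤ → ℝ → M2
  | Int.ofNat n => legendreCoeff K n
  | Int.negSucc _ => -legendreCoeff K 0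

/-- `θ_n(x) = x^n K_n(x)`, for `n ≥ -1`. -/
def theta (K : ℝ → ℝ → M2) (n : ℤ) (x : ℝ) : M2 := x ^ n • legendreCoeffExt K n x

/-- The solution operator `S[H](x) = V(x) ∫_0^x V(t)⁻¹ Bᵀ H(t) dt` of the inhomogeneous equation
`B Y' + Q Y = H`, `Y(0) = 0`, where `V = U(0, ·)`. -/
def solOp (V : ℝ → M2) (H : ℝ → M2) (x : ℝ) : M2 :=
  V x * ∫ t in (0 : ℝ)..x, (V t)⁻¹ * Bᵀ * H t

end Dirac

end

/-! Transmutation. Substituting `t = x s` turns `∫ K(x,t) U₀(lam,t) dt` into an integral over the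
fixed interval `[-1, 1]`. Differentiating in `x`, inserting the equation for `K` and integrating a
total `s`-derivative shows that the transmuted free solution solves the Dirac equation: the two
boundary conditions on `K` are exactly what the endpoint terms require
(`IsGoursatKernel.hasDerivWithinAt_integral`, `isSolution_transmuted`). This also constructs `U`,
once `K` exists; uniqueness for the linear ODE then covers every `U`.

Existence of `K`. Split `K` into the parts commuting and anticommuting with `B`. Since `Q`
anticommutes with `B`, it exchanges the two parts, and each part has a prescribed derivative along
one characteristic direction. A single Volterra equation with swapped arguments encodes both, and
Picard iteration solves it (`exists_volterra_solution`, `exists_isGoursatKernel`).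

Series. No pointwise convergence of the Legendre series of `K` is needed. The exponential is
expanded in powers and each power in finitely many `P_n`; the double series converges absolutely, so
it may be summed in either order (`hasSum_legendre_exp`). Splitting `U₀` into two exponentials by
the spectral projections of `B`, and using `∫ e^{izs} P_n(s) ds = 2 i^n j_n(z)`, gives the Bessel
series.

Recursion. The same integral identity is applied with the scalar polynomial `R = P_{k+1} - P_{k-1}`
in place of the free solution. Here `R(1) = 0`, `R' = (2k+1) P_k` and `X R' - (k+1) R = (2k+1)
P_{k-1}`, so `x^{k+2}` times the moment of `R` solves an inhomogeneous Dirac equation whose right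
side involves only the moments of `P_k` and `P_{k-1}`. Variation of constants solves it
(`moment_recursion`); rescaling moments to `θ_n` yields the stated formula. The case `k = 0` fits
with `P_{-1} = 1`, which is the meaning of `K_{-1} = -K_0`. -/

namespace Dirac

/-! ### Legendre polynomials: recurrences, moments, expansion of monomials. -/

section Legendre

open Polynomial

theorem derivative_X_sq_sub_one_pow (n : ℕ) :
    derivative ((X ^ 2 - 1 : ℝ[X]) ^ (n + 1)) =
      C (2 * ((n : ℝ) + 1)) * ((X ^ 2 - 1) ^ n * X) := by
  rw [derivative_pow]
  simp only [Nat.add_sub_cancel, derivative_sub, derivative_X_sq, derivative_one, sub_zero,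
    Nat.cast_add, Nat.cast_one, map_mul, map_add, map_one]
  ring

theorem legendreP_zero : legendreP 0 = 1 := by simp [legendreP]

theorem legendreP_one : legendreP 1 = X := by
  simp only [legendreP, pow_one, Nat.factorial_one, Nat.cast_one, mul_one, Function.iterate_one,
    derivative_sub, derivative_X_sq, derivative_one, sub_zero]
  rw [← mul_assoc, ← C_mul]
  norm_num

/-- One derivative of `(X² - 1)^(n+2)` produces a factor `X`, and Leibniz against `X` has only two
terms. The remainder vanishes at `±1`, and its derivative is a multiple of `P_{n+1}`; both facts are
used below. -/
theorem legendreP_succ_eq (n : ℕ) :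
    legendreP (n + 2) = X * legendreP (n + 1) +
      C (((n : ℝ) + 1) / (2 ^ (n + 1) * ((n + 1)! : ℝ))) *
        derivative^[n] ((X ^ 2 - 1) ^ (n + 1)) := by
  unfold legendreP
  rw [Function.iterate_succ_apply, derivative_X_sq_sub_one_pow, iterate_derivative_C_mul,
    iterate_derivative_mul_X, ← mul_assoc, ← C_mul]
  have h1 : (1 / (2 ^ (n + 2) * ((n + 2)! : ℝ)) * (2 * (((n + 1 : ℕ) : ℝ) + 1))) =
      1 / (2 ^ (n + 1) * ((n + 1)! : ℝ)) := by
    rw [Nat.factorial_succ (n + 1)]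
    have := Nat.factorial_pos (n + 1)
    push_cast
    field_simp
    ring
  rw [h1]
  have h2 : C (((n : ℝ) + 1) / (2 ^ (n + 1) * ((n + 1)! : ℝ))) =
      C (1 / (2 ^ (n + 1) * ((n + 1)! : ℝ))) * C ((n : ℝ) + 1) := by
    rw [← C_mul]; ring_nf
  rw [h2]
  simp only [Nat.add_sub_cancel, nsmul_eq_mul, Nat.cast_add, Nat.cast_one, map_add, map_natCast,
    map_one]
  ring

theorem derivative_legendreP_add_two (n : ℕ) :
    derivative (legendreP (n + 2)) =
      X * derivative (legendreP (n + 1)) + C ((n : ℝ) + 2) * legendreP (n + 1) := by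
  rw [legendreP_succ_eq]
  simp only [derivative_add, derivative_mul, derivative_X, derivative_C]
  rw [← Function.iterate_succ_apply' derivative n]
  have h2 : C (((n : ℝ) + 1) / (2 ^ (n + 1) * ((n + 1)! : ℝ))) =
      C (1 / (2 ^ (n + 1) * ((n + 1)! : ℝ))) * C ((n : ℝ) + 1) := by
    rw [← C_mul]; ring_nf
  rw [h2]
  unfold legendreP
  simp only [map_add, map_natCast, map_one, map_ofNat]
  ring

/-- Differentiate `(X² - 1)^(n+2)` twice and write the resulting `X²` as `(X² - 1) + 1`; the
remaining `n + 1` derivatives give the two terms on the right. -/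
theorem derivative_legendreP_sub (n : ℕ) :
    derivative (legendreP (n + 2)) =
      C (2 * (n : ℝ) + 3) * legendreP (n + 1) + derivative (legendreP n) := by
  unfold legendreP
  have h : derivative (derivative ((X ^ 2 - 1 : ℝ[X]) ^ (n + 2))) =
      C (2 * ((n : ℝ) + 2)) * (C (2 * (n : ℝ) + 3) * (X ^ 2 - 1) ^ (n + 1)
        + C (2 * ((n : ℝ) + 1)) * (X ^ 2 - 1) ^ n) := by
    rw [derivative_X_sq_sub_one_pow, derivative_C_mul, derivative_mul,
      derivative_X_sq_sub_one_pow]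
    simp only [derivative_X, map_mul, map_add, map_natCast, map_one, map_ofNat, Nat.cast_add,
      Nat.cast_one]
    ring
  have h' : derivative^[n + 2 + 1] ((X ^ 2 - 1 : ℝ[X]) ^ (n + 2)) =
      C (2 * ((n : ℝ) + 2)) * (C (2 * (n : ℝ) + 3) * derivative^[n + 1] ((X ^ 2 - 1) ^ (n + 1))
        + C (2 * ((n : ℝ) + 1)) * derivative^[n + 1] ((X ^ 2 - 1) ^ n)) := by
    rw [show n + 2 + 1 = (n + 1) + 2 from rfl, Function.iterate_add_apply]
    simp only [Function.iterate_succ_apply _ 1, Function.iterate_one]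
    rw [h, iterate_derivative_C_mul, iterate_map_add, iterate_derivative_C_mul,
      iterate_derivative_C_mul]
  simp only [derivative_C_mul]
  rw [← Function.iterate_succ_apply' derivative (n + 2),
    ← Function.iterate_succ_apply' derivative n, h']
  have hn := (Nat.factorial_pos n)
  have e1 : C (1 / (2 ^ (n + 2) * ((n + 2)! : ℝ))) * C (2 * ((n : ℝ) + 2)) =
      C (1 / (2 ^ (n + 1) * ((n + 1)! : ℝ))) := by
    rw [← C_mul, Nat.factorial_succ (n + 1), Nat.factorial_succ n]
    congr 1
    push_cast
    field_simp
    ring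
  have e2 : C (1 / (2 ^ (n + 1) * ((n + 1)! : ℝ))) * C (2 * ((n : ℝ) + 1)) =
      C (1 / (2 ^ n * ((n)! : ℝ))) := by
    rw [← C_mul, Nat.factorial_succ n]
    congr 1
    push_cast
    field_simp
    ring
  rw [← mul_assoc, e1, mul_add, ← mul_assoc _ _ (derivative^[n + 1] ((X ^ 2 - 1) ^ n)), e2]
  ring

theorem eval_iterate_derivative_X_sq_sub_one (n : ℕ) {s : ℝ} (hs : s ^ 2 = 1) :
    eval s (derivative^[n] ((X ^ 2 - 1 : ℝ[X]) ^ (n + 1))) = 0 := by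
  have h := pow_sub_dvd_iterate_derivative_pow (X ^ 2 - 1 : ℝ[X]) (n + 1) n
  rw [Nat.add_sub_cancel_left, pow_one] at h
  obtain ⟨r, hr⟩ := h
  rw [hr]
  simp [hs]

theorem eval_legendreP_of_sq_eq_one (n : ℕ) {s : ℝ} (hs : s ^ 2 = 1) :
    eval s (legendreP n) = s ^ n := by
  induction n using Nat.twoStepInduction with
  | zero => simp [legendreP_zero]
  | one => simp [legendreP_one]
  | more n _ ih =>
    rw [legendreP_succ_eq, eval_add, eval_mul, ih, eval_mul,
      eval_iterate_derivative_X_sq_sub_one n hs]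
    simp only [eval_X]
    ring

/-- The three-term recurrence of Bonnet. -/
theorem legendreP_bonnet (n : ℕ) :
    C ((n : ℝ) + 2) * legendreP (n + 2) =
      C (2 * (n : ℝ) + 3) * (X * legendreP (n + 1)) - C ((n : ℝ) + 1) * legendreP n := by
  -- The difference of the two sides is constant by the two derivative identities, and every `P_n`
  -- equals `1` at `1`.
  have hd : derivative (C ((n : ℝ) + 2) * legendreP (n + 2) -
      (C (2 * (n : ℝ) + 3) * (X * legendreP (n + 1)) - C ((n : ℝ) + 1) * legendreP n)) = 0 := by
    have h1 := derivative_legendreP_add_two n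
    have h2 := derivative_legendreP_sub n
    simp only [derivative_sub, derivative_mul, derivative_X, derivative_C]
    have h3 : X * derivative (legendreP (n + 1)) =
        derivative (legendreP (n + 2)) - C ((n : ℝ) + 2) * legendreP (n + 1) := by
      rw [h1]; ring
    rw [h3, h2]
    simp only [map_mul, map_add, map_natCast, map_one, map_ofNat]
    ring
  rw [← sub_eq_zero, eq_C_of_derivative_eq_zero hd, C_eq_zero, coeff_zero_eq_eval_zero]
  have h1 := congrArg (eval 1) (eq_C_of_derivative_eq_zero hd)
  rw [eval_C, coeff_zero_eq_eval_zero] at h1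
  rw [← h1]
  simp only [eval_sub, eval_mul, eval_C, eval_X, eval_legendreP_of_sq_eq_one _ (one_pow 2),
    one_pow]
  ring

/-- Multiplication by the variable, with the convention that the last term vanishes
for `n = 0`. -/
theorem X_mul_legendreP (n : ℕ) (s : ℝ) :
    (2 * (n : ℝ) + 1) * (s * (legendreP n).eval s) =
      ((n : ℝ) + 1) * (legendreP (n + 1)).eval s + n * (legendreP (n - 1)).eval s := by
  cases n with
  | zero => simp [legendreP_zero, legendreP_one]
  | succ n =>
    have h := congrArg (eval s) (legendreP_bonnet n)
    simp only [eval_sub, eval_mul, eval_C, eval_X] at h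
    simp only [Nat.add_sub_cancel]
    push_cast
    rw [show n + 1 + 1 = n + 2 from rfl]
    linear_combination -h

/-- A crude bound read off from Bonnet's recurrence. Exponential growth in `n` is harmless later,
where it is absorbed by the `1 / m!` of the exponential series with `n ≤ m`. -/
theorem abs_eval_legendreP_le (n : ℕ) {s : ℝ} (hs : s ∈ Icc (-1 : ℝ) 1) :
    |(legendreP n).eval s| ≤ 3 ^ n := by
  have hs' : |s| ≤ 1 := abs_le.2 hs
  induction n using Nat.twoStepInduction with
  | zero => simp [legendreP_zero]
  | one => simpa [legendreP_one] using hs'.trans (by norm_num)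
  | more n ih0 ih1 =>
    have h := congrArg (eval s) (legendreP_bonnet n)
    simp only [eval_sub, eval_mul, eval_C, eval_X] at h
    have hn : (0 : ℝ) < (n : ℝ) + 2 := by positivity
    have h1 : |s * (legendreP (n + 1)).eval s| ≤ 3 ^ (n + 1) := by
      rw [abs_mul]
      calc _ ≤ 1 * 3 ^ (n + 1) := mul_le_mul hs' ih1 (abs_nonneg _) zero_le_one
        _ = _ := one_mul _
    have h2 : ((n : ℝ) + 2) * |(legendreP (n + 2)).eval s| ≤ ((n : ℝ) + 2) * 3 ^ (n + 2) := by
      calc ((n : ℝ) + 2) * |(legendreP (n + 2)).eval s|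
          = |((n : ℝ) + 2) * (legendreP (n + 2)).eval s| := by
            rw [abs_mul, abs_of_pos hn]
        _ = |(2 * (n : ℝ) + 3) * (s * (legendreP (n + 1)).eval s) -
              ((n : ℝ) + 1) * (legendreP n).eval s| := by rw [h]
        _ ≤ (2 * (n : ℝ) + 3) * 3 ^ (n + 1) + ((n : ℝ) + 1) * 3 ^ n := by
            refine (abs_sub _ _).trans ?_
            rw [abs_mul, abs_mul ((n : ℝ) + 1), abs_of_pos (by positivity : (0 : ℝ) < 2 * (n : ℝ) + 3),
              abs_of_pos (by positivity : (0 : ℝ) < (n : ℝ) + 1)]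
            gcongr
        _ ≤ _ := by
            have : (0 : ℝ) < 3 ^ n := by positivity
            rw [pow_succ, pow_add]
            nlinarith [(Nat.cast_nonneg n : (0 : ℝ) ≤ n)]
    exact le_of_mul_le_mul_left h2 hn

/-- The moments of the Legendre polynomials. -/
noncomputable def legendreMoment (m n : ℕ) : ℝ :=
  ∫ s in (-1 : ℝ)..1, s ^ m * (legendreP n).eval s

theorem continuous_eval_legendreP (n : ℕ) : Continuous fun s : ℝ => (legendreP n).eval s :=
  (legendreP n).continuous

theorem intervalIntegrable_pow_mul_legendreP (m n : ℕ) :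
    IntervalIntegrable (fun s : ℝ => s ^ m * (legendreP n).eval s) volume (-1) 1 :=
  ((continuous_pow m).mul (continuous_eval_legendreP n)).intervalIntegrable _ _

theorem legendreMoment_succ_left (m n : ℕ) :
    (2 * (n : ℝ) + 1) * legendreMoment (m + 1) n =
      ((n : ℝ) + 1) * legendreMoment m (n + 1) + n * legendreMoment m (n - 1) := by
  unfold legendreMoment
  rw [← intervalIntegral.integral_const_mul, ← intervalIntegral.integral_const_mul,
    ← intervalIntegral.integral_const_mul, ← intervalIntegral.integral_add
      ((intervalIntegrable_pow_mul_legendreP _ _).const_mul _)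
      ((intervalIntegrable_pow_mul_legendreP _ _).const_mul _)]
  refine intervalIntegral.integral_congr fun s _ => ?_
  have := X_mul_legendreP n s
  linear_combination s ^ m * this

theorem legendreMoment_by_parts (m n : ℕ) :
    (2 * (n : ℝ) + 3) * legendreMoment m (n + 1) =
      m * (legendreMoment (m - 1) n - legendreMoment (m - 1) (n + 2)) := by
  have key : ∫ s in (-1 : ℝ)..1, ((m : ℝ) * s ^ (m - 1) * ((legendreP (n + 2)).eval s
        - (legendreP n).eval s) + s ^ m * ((2 * (n : ℝ) + 3) * (legendreP (n + 1)).eval s)) = 0 := by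
    rw [intervalIntegral.integral_eq_sub_of_hasDerivAt (f := fun s : ℝ =>
      s ^ m * ((legendreP (n + 2)).eval s - (legendreP n).eval s))]
    · rw [eval_legendreP_of_sq_eq_one (n + 2) (one_pow 2),
        eval_legendreP_of_sq_eq_one (n + 2) (by norm_num : (-1 : ℝ) ^ 2 = 1),
        eval_legendreP_of_sq_eq_one n (one_pow 2),
        eval_legendreP_of_sq_eq_one n (by norm_num : (-1 : ℝ) ^ 2 = 1)]
      ring
    · intro s _
      have h1 : HasDerivAt (fun s : ℝ => (legendreP (n + 2)).eval s - (legendreP n).eval s)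
          ((2 * (n : ℝ) + 3) * (legendreP (n + 1)).eval s) s := by
        have h := ((legendreP (n + 2)).hasDerivAt s).fun_sub ((legendreP n).hasDerivAt s)
        rw [derivative_legendreP_sub, eval_add, eval_mul, eval_C, add_sub_cancel_right] at h
        exact h
      exact (hasDerivAt_pow m s).mul h1
    · apply Continuous.intervalIntegrable
      have := continuous_eval_legendreP n
      have := continuous_eval_legendreP (n + 1)
      have := continuous_eval_legendreP (n + 2)
      fun_prop
  have hI := intervalIntegrable_pow_mul_legendreP
  have e : ∀ s : ℝ, ((m : ℝ) * s ^ (m - 1) * ((legendreP (n + 2)).eval s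
        - (legendreP n).eval s) + s ^ m * ((2 * (n : ℝ) + 3) * (legendreP (n + 1)).eval s)) =
      ((m : ℝ) * (s ^ (m - 1) * (legendreP (n + 2)).eval s)
        - (m : ℝ) * (s ^ (m - 1) * (legendreP n).eval s))
        + (2 * (n : ℝ) + 3) * (s ^ m * (legendreP (n + 1)).eval s) := by intro s; ring
  simp_rw [e] at key
  rw [intervalIntegral.integral_add (((hI _ _).const_mul _).sub ((hI _ _).const_mul _))
    ((hI _ _).const_mul _), intervalIntegral.integral_sub ((hI _ _).const_mul _)
    ((hI _ _).const_mul _)] at key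
  simp only [intervalIntegral.integral_const_mul] at key
  unfold legendreMoment
  linear_combination key

/-- Multiplication by the variable and integration by parts both involve the moments with indices
`n` and `n + 2`; eliminating the latter leaves a recurrence along the diagonal. It reduces
vanishing, parity and explicit values to moments with one index zero. -/
theorem legendreMoment_succ_succ (m n : ℕ) :
    ((m : ℝ) + n + 3) * legendreMoment (m + 1) (n + 1) = (m + 1) * legendreMoment m n := by
  have h1 := legendreMoment_succ_left m (n + 1)
  have h2 := legendreMoment_by_parts (m + 1) n
  simp only [Nat.add_sub_cancel] at h1 h2
  push_cast at h1 h2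
  rw [show n + 1 + 1 = n + 2 from rfl] at h1
  have h3 : (2 * (n : ℝ) + 3) * (((m : ℝ) + n + 3) * legendreMoment (m + 1) (n + 1)) =
      (2 * (n : ℝ) + 3) * ((m + 1) * legendreMoment m n) := by
    linear_combination ((m : ℝ) + 1) * h1 + ((n : ℝ) + 2) * h2
  exact mul_left_cancel₀ (by positivity) h3

theorem legendreMoment_zero_succ (n : ℕ) : legendreMoment 0 (n + 1) = 0 := by
  have h := legendreMoment_by_parts 0 n
  rw [Nat.cast_zero, zero_mul] at h
  exact (mul_eq_zero.1 h).resolve_left (by positivity)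

theorem legendreMoment_of_lt {m n : ℕ} (h : m < n) : legendreMoment m n = 0 := by
  induction m generalizing n with
  | zero =>
    obtain ⟨n, rfl⟩ := Nat.exists_eq_succ_of_ne_zero h.ne'
    exact legendreMoment_zero_succ n
  | succ m ih =>
    obtain ⟨n, rfl⟩ := Nat.exists_eq_succ_of_ne_zero (Nat.ne_zero_of_lt h)
    have h1 := legendreMoment_succ_succ m n
    rw [ih (Nat.lt_of_succ_lt_succ h), mul_zero] at h1
    exact (mul_eq_zero.1 h1).resolve_left (by positivity)

theorem legendreMoment_odd (n k : ℕ) : legendreMoment (n + (2 * k + 1)) n = 0 := by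
  induction n with
  | zero =>
    simp only [legendreMoment, legendreP_zero, eval_one, mul_one, integral_pow]
    rw [show 0 + (2 * k + 1) + 1 = 2 * (k + 1) by ring, pow_mul, pow_mul]
    norm_num
  | succ n ih =>
    have h1 := legendreMoment_succ_succ (n + (2 * k + 1)) n
    rw [ih, mul_zero] at h1
    rw [show n + 1 + (2 * k + 1) = n + (2 * k + 1) + 1 by ring]
    exact (mul_eq_zero.1 h1).resolve_left (by positivity)

theorem factorial_two_mul (k : ℕ) : ((2 * k + 1)! : ℝ) = 2 ^ k * k ! * ((2 * k + 1)‼ : ℝ) := by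
  rw [Nat.factorial_eq_mul_doubleFactorial, Nat.doubleFactorial_two_mul]
  push_cast
  ring

theorem legendreMoment_even (n k : ℕ) :
    legendreMoment (n + 2 * k) n =
      2 * ((n + 2 * k)! : ℝ) / (2 ^ k * k ! * ((2 * n + 2 * k + 1)‼ : ℝ)) := by
  induction n with
  | zero =>
    simp only [legendreMoment, legendreP_zero, eval_one, mul_one, integral_pow]
    rw [show 2 * 0 + 2 * k + 1 = 2 * k + 1 by ring, ← factorial_two_mul, zero_add,
      Nat.factorial_succ, one_pow, Odd.neg_one_pow ⟨k, rfl⟩]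
    have := Nat.factorial_pos (2 * k)
    push_cast
    field_simp
    norm_num
  | succ n ih =>
    have h1 := legendreMoment_succ_succ (n + 2 * k) n
    rw [ih] at h1
    rw [show n + 1 + 2 * k = n + 2 * k + 1 by ring,
      show 2 * (n + 1) + 2 * k + 1 = 2 * n + 2 * k + 1 + 2 by ring, Nat.doubleFactorial_add_two,
      Nat.factorial_succ]
    have h2 := Nat.factorial_pos k
    have h3 := Nat.doubleFactorial_pos (2 * n + 2 * k + 1)
    have h4 : ((n + 2 * k : ℕ) : ℝ) + n + 3 ≠ 0 := by positivity
    refine mul_left_cancel₀ h4 (h1.trans ?_)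
    push_cast
    field_simp
    ring

theorem abs_legendreMoment_le (m n : ℕ) : |legendreMoment m n| ≤ 2 * 3 ^ n := by
  have h := intervalIntegral.norm_integral_le_of_norm_le_const (a := (-1 : ℝ)) (b := 1)
    (f := fun s : ℝ => s ^ m * (legendreP n).eval s) (C := 3 ^ n) (by
      intro s hs
      rw [uIoc_of_le (by norm_num)] at hs
      have hs' : s ∈ Icc (-1 : ℝ) 1 := ⟨hs.1.le, hs.2⟩
      rw [norm_mul, norm_pow]
      have h1 : ‖s‖ ^ m ≤ 1 := pow_le_one₀ (norm_nonneg _) (abs_le.2 hs')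
      calc _ ≤ 1 * 3 ^ n := mul_le_mul h1 (abs_eval_legendreP_le n hs') (abs_nonneg _) zero_le_one
        _ = _ := one_mul _)
  unfold legendreMoment
  rw [Real.norm_eq_abs] at h
  refine h.trans (le_of_eq ?_)
  norm_num
  ring

/-- The Legendre expansion of the monomials. -/
theorem pow_eq_sum_legendreP (m : ℕ) (s : ℝ) (N : ℕ) (hN : m < N) :
    s ^ m = ∑ n ∈ Finset.range N,
      (2 * (n : ℝ) + 1) / 2 * legendreMoment m n * (legendreP n).eval s := by
  induction m generalizing N with
  | zero =>
    rw [Finset.sum_eq_single 0]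
    · norm_num [legendreMoment, legendreP_zero]
    · intro n _ hn
      rw [legendreMoment_of_lt (Nat.pos_of_ne_zero hn)]
      simp
    · intro h
      simp at h
      omega
  | succ m ih =>
    obtain ⟨N, rfl⟩ : ∃ M, N = M + 1 := ⟨N - 1, by omega⟩
    have hm : m < N := by omega
    have e1 : ∀ n : ℕ, (2 * (n : ℝ) + 1) / 2 * legendreMoment (m + 1) n * (legendreP n).eval s =
        (((n : ℝ) + 1) * legendreMoment m (n + 1) * (legendreP n).eval s) / 2
        + (n * legendreMoment m (n - 1) * (legendreP n).eval s) / 2 := by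
      intro n
      linear_combination (legendreP n).eval s / 2 * legendreMoment_succ_left m n
    have e2 : ∀ n : ℕ, (2 * (n : ℝ) + 1) / 2 * legendreMoment m n * (legendreP n).eval s * s =
        (n * legendreMoment m n * (legendreP (n - 1)).eval s) / 2
        + (((n : ℝ) + 1) * legendreMoment m n * (legendreP (n + 1)).eval s) / 2 := by
      intro n
      linear_combination legendreMoment m n / 2 * X_mul_legendreP n s
    rw [pow_succ]
    -- Multiplication by `s` shifts the index by one either way. Using `N + 2` terms for `s ^ m`
    -- makes the shifted sums match those for `s ^ (m + 1)`; the surplus moments vanish since `m <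
    -- N`.
    nth_rw 1 [ih (N + 2) (by omega)]
    rw [Finset.sum_mul, Finset.sum_congr rfl fun n _ => e2 n, Finset.sum_congr rfl fun n _ => e1 n,
      Finset.sum_add_distrib, Finset.sum_add_distrib]
    congr 1
    · rw [Finset.sum_range_succ' _ (N + 1)]
      simp
    · rw [Finset.sum_range_succ, Finset.sum_range_succ, Finset.sum_range_succ' _ N,
        legendreMoment_of_lt (m := m) (n := N) hm, legendreMoment_of_lt (m := m) (n := N + 1) (by omega)]
      simp

end Legendre

/-! ### Exponentials against Legendre polynomials; termwise integration. -/

section Series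

theorem hasSum_of_eq {ι M : Type*} [AddCommMonoid M] [TopologicalSpace M] {f g : ι → M} {a : M}
    (h : HasSum f a) (e : ∀ i, g i = f i) : HasSum g a := by
  rwa [funext e]

variable {E : Type*} [NormedAddCommGroup E] [NormedSpace ℝ E]

theorem norm_integral_legendreP_smul_le {k : ℝ → E} (hk : IntervalIntegrable k volume (-1) 1)
    (n : ℕ) : ‖∫ s in (-1 : ℝ)..1, (legendreP n).eval s • k s‖ ≤
      3 ^ n * ∫ s in (-1 : ℝ)..1, ‖k s‖ := by
  rw [← intervalIntegral.integral_const_mul]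
  refine intervalIntegral.norm_integral_le_of_norm_le (by norm_num) (ae_of_all _ fun s hs => ?_)
    (hk.norm.const_mul _)
  rw [norm_smul]
  gcongr
  exact abs_eval_legendreP_le n ⟨hs.1.le, hs.2⟩

theorem integral_pow_smul_eq_sum {k : ℝ → E} (hk : IntervalIntegrable k volume (-1) 1) (m N : ℕ)
    (hN : m < N) :
    ∫ s in (-1 : ℝ)..1, s ^ m • k s = ∑ n ∈ Finset.range N,
      ((2 * (n : ℝ) + 1) / 2 * legendreMoment m n) •
        ∫ s in (-1 : ℝ)..1, (legendreP n).eval s • k s := by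
  simp_rw [← intervalIntegral.integral_smul]
  rw [← intervalIntegral.integral_finsetSum]
  · refine intervalIntegral.integral_congr fun s _ => ?_
    rw [pow_eq_sum_legendreP m s N hN, Finset.sum_smul]
    simp_rw [smul_smul]
  · intro n _
    exact (hk.continuousOn_smul (continuous_eval_legendreP n).continuousOn).smul _

variable [NormedSpace ℂ E] [IsScalarTower ℝ ℂ E]

theorem ofReal_smul_eq (r : ℝ) (e : E) : (r : ℂ) • e = r • e := algebraMap_smul ℂ r e

theorem hasSum_exp_smul (w : ℂ) (s : ℝ) (e : E) :
    HasSum (fun m : ℕ => (w ^ m / (m ! : ℂ)) • (s ^ m • e)) (Complex.exp (w * s) • e) := by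
  have h : HasSum (fun m : ℕ => (w * s) ^ m / (m ! : ℂ)) (Complex.exp (w * s)) := by
    rw [Complex.exp_eq_exp_ℂ]
    refine hasSum_of_eq (NormedSpace.exp_series_hasSum_exp' (𝔸 := ℂ) (𝕂 := ℂ) (w * s)) fun m => ?_
    rw [smul_eq_mul, div_eq_inv_mul]
  refine hasSum_of_eq (h.smul_const e) fun m => ?_
  rw [← ofReal_smul_eq, smul_smul, mul_pow]
  push_cast
  congr 1
  ring

theorem hasSum_integral_exp_smul {k : ℝ → E} (hk : IntervalIntegrable k volume (-1) 1) (w : ℂ) :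
    HasSum (fun m : ℕ => (w ^ m / (m ! : ℂ)) • ∫ s in (-1 : ℝ)..1, s ^ m • k s)
      (∫ s in (-1 : ℝ)..1, Complex.exp (w * s) • k s) := by
  simp_rw [← intervalIntegral.integral_smul]
  refine intervalIntegral.hasSum_integral_of_dominated_convergence
    (fun m s => (‖w‖ ^ m / (m ! : ℝ)) * ‖k s‖) (fun m => ?_) (fun m => ?_) ?_ ?_ ?_
  · have := hk.aestronglyMeasurable
    rw [uIoc_of_le (by norm_num)]
    exact (((continuous_pow m).aestronglyMeasurable).smul this).const_smul _
  · refine ae_of_all _ fun s hs => ?_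
    rw [uIoc_of_le (by norm_num)] at hs
    have h1 : ‖s‖ ^ m ≤ 1 := pow_le_one₀ (norm_nonneg _) (abs_le.2 ⟨hs.1.le, hs.2⟩)
    rw [norm_smul, norm_smul, norm_div, norm_pow, Complex.norm_natCast, norm_pow]
    gcongr
    calc ‖s‖ ^ m * ‖k s‖ ≤ 1 * ‖k s‖ := by gcongr
      _ = _ := one_mul _
  · exact ae_of_all _ fun s _ => (Real.summable_pow_div_factorial ‖w‖).mul_right _
  · simp_rw [tsum_mul_right]
    exact hk.norm.const_mul _
  · exact ae_of_all _ fun s _ => hasSum_exp_smul w s (k s)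

theorem hasSum_integral_exp_legendreP (w : ℂ) (n : ℕ) :
    HasSum (fun m : ℕ => (w ^ m / (m ! : ℂ)) * (legendreMoment m n : ℂ))
      (∫ s in (-1 : ℝ)..1, Complex.exp (w * s) * ((legendreP n).eval s : ℝ)) := by
  have h := hasSum_integral_exp_smul (k := fun s => (((legendreP n).eval s : ℝ) : ℂ))
    ((Complex.continuous_ofReal.comp (continuous_eval_legendreP n)).intervalIntegrable _ _) w
  refine hasSum_of_eq h fun m => ?_
  rw [smul_eq_mul]
  congr 1
  unfold legendreMoment
  rw [← intervalIntegral.integral_ofReal]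
  refine intervalIntegral.integral_congr fun s _ => ?_
  simp

/-- In the power series of the exponential only the moments of order `m = n + 2k` survive, and their
explicit values reproduce the power series of `j_n`. -/
theorem integral_exp_legendreP (z : ℂ) (n : ℕ) :
    ∫ s in (-1 : ℝ)..1, Complex.exp (Complex.I * z * s) * ((legendreP n).eval s : ℝ) =
      2 * Complex.I ^ n * sphBessel n z := by
  have h := hasSum_integral_exp_legendreP (Complex.I * z) n
  have hinj : Function.Injective fun k : ℕ => n + 2 * k := fun a c h => by
    simp only at h; omega
  rw [← hinj.hasSum_iff] at h
  · rw [← h.tsum_eq, sphBessel, ← tsum_mul_left, ← tsum_mul_left]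
    refine tsum_congr fun k => ?_
    have h1 := Nat.factorial_pos (n + 2 * k)
    have h2 := Nat.factorial_pos k
    have h3 := Nat.doubleFactorial_pos (2 * n + 2 * k + 1)
    simp only [Function.comp_apply, legendreMoment_even]
    push_cast
    have h1' : ((n + 2 * k)! : ℂ) ≠ 0 := by exact_mod_cast h1.ne'
    have h2' : (k ! : ℂ) ≠ 0 := by exact_mod_cast h2.ne'
    have h3' : ((2 * n + 2 * k + 1)‼ : ℂ) ≠ 0 := by exact_mod_cast h3.ne'
    rw [mul_pow, pow_add Complex.I, pow_mul Complex.I, Complex.I_sq, pow_add z, pow_mul z,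
      div_pow, neg_pow (z ^ 2)]
    field_simp
  · intro m hm
    have hm' : legendreMoment m n = 0 := by
      rcases lt_or_ge m n with hlt | hge
      · exact legendreMoment_of_lt hlt
      · obtain ⟨j, rfl⟩ := Nat.exists_eq_add_of_le hge
        rcases Nat.even_or_odd' j with ⟨k, rfl | rfl⟩
        · exact absurd ⟨k, rfl⟩ hm
        · exact legendreMoment_odd n k
    simp [hm']

theorem sphBessel_neg (n : ℕ) (z : ℂ) : sphBessel n (-z) = (-1) ^ n * sphBessel n z := by
  rw [sphBessel, sphBessel, neg_pow, neg_sq]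
  ring

/-- The Fourier–Legendre series of an exponential may be integrated term by term against an
integrable function. -/
theorem hasSum_legendre_exp [CompleteSpace E] {k : ℝ → E} (hk : IntervalIntegrable k volume (-1) 1)
    (w : ℂ) :
    HasSum (fun n : ℕ => ((2 * (n : ℂ) + 1) / 2 *
        ∫ s in (-1 : ℝ)..1, Complex.exp (w * s) * ((legendreP n).eval s : ℝ)) •
        ∫ s in (-1 : ℝ)..1, (legendreP n).eval s • k s)
      (∫ s in (-1 : ℝ)..1, Complex.exp (w * s) • k s) := by
  set C := ∫ s in (-1 : ℝ)..1, ‖k s‖ with hC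
  have hC0 : 0 ≤ C := intervalIntegral.integral_nonneg (by norm_num) fun s _ => norm_nonneg _
  set c : ℕ → E := fun n => ∫ s in (-1 : ℝ)..1, (legendreP n).eval s • k s with hc
  -- Summing over the Legendre index first gives the power series of the integral; summing over the
  -- power first gives the Legendre series.
  set F : ℕ × ℕ → E := fun x => ((w ^ x.1 / (x.1 ! : ℂ)) *
    ((2 * (x.2 : ℂ) + 1) / 2 * (legendreMoment x.1 x.2 : ℂ))) • c x.2 with hF
  have hsum : Summable F := by
    -- Only `n ≤ m` contributes. There the factors `2 * 2^n`, `2 * 3^n` and `3^n * C` give a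
    -- multiple of `18^n = 36^n * (1/2)^n`, and `36^n ≤ 36^m` leaves a geometric series in `n`.
    have hb : Summable fun x : ℕ × ℕ =>
        ((36 * ‖w‖) ^ x.1 / (x.1 ! : ℝ)) * (4 * C * (1 / 2) ^ x.2) :=
      (Real.summable_pow_div_factorial (36 * ‖w‖)).mul_of_nonneg
        (summable_geometric_two.mul_left (4 * C)) (fun m => by positivity) (fun n => by positivity)
    refine Summable.of_norm_bounded hb fun ⟨m, n⟩ => ?_
    rcases lt_or_ge m n with hmn | hmn
    · simp only [hF, legendreMoment_of_lt hmn]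
      simp only [Complex.ofReal_zero, mul_zero, zero_smul, norm_zero]
      positivity
    · have h1 : (2 * (n : ℝ) + 1) ≤ 2 * 2 ^ n := by
        have : ((n : ℝ) + 1) ≤ 2 ^ n := by exact_mod_cast Nat.lt_two_pow_self (n := n)
        linarith
      have h2 : (36 : ℝ) ^ n ≤ 36 ^ m := pow_le_pow_right₀ (by norm_num) hmn
      have h3 : ‖(2 * (n : ℂ) + 1)‖ = 2 * (n : ℝ) + 1 := by
        rw [show (2 * (n : ℂ) + 1) = ((2 * (n : ℝ) + 1 : ℝ) : ℂ) by push_cast; rfl,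
          Complex.norm_real, Real.norm_of_nonneg (by positivity)]
      simp only [hF]
      rw [norm_smul, norm_mul, norm_mul, norm_div, norm_div, norm_pow, Complex.norm_natCast, h3,
        Complex.norm_ofNat, Complex.norm_real, Real.norm_eq_abs]
      calc ‖w‖ ^ m / (m ! : ℝ) * ((2 * (n : ℝ) + 1) / 2 * |legendreMoment m n|) * ‖c n‖
          ≤ ‖w‖ ^ m / (m ! : ℝ) * ((2 * 2 ^ n) / 2 * (2 * 3 ^ n)) * (3 ^ n * C) := by
            gcongr
            · exact abs_legendreMoment_le m n
            · exact norm_integral_legendreP_smul_le hk n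
        _ = ‖w‖ ^ m / (m ! : ℝ) * (36 ^ n * (2 * C * (1 / 2) ^ n)) := by
            rw [show (36 : ℝ) ^ n = 2 ^ n * 2 ^ n * 3 ^ n * 3 ^ n by
              simp_rw [← mul_pow]; norm_num, one_div, inv_pow]
            field_simp
        _ ≤ ‖w‖ ^ m / (m ! : ℝ) * (36 ^ m * (4 * C * (1 / 2) ^ n)) := by
            gcongr
            norm_num
        _ = _ := by rw [mul_pow]; ring
  have h1 : HasSum (fun m : ℕ => (w ^ m / (m ! : ℂ)) • ∫ s in (-1 : ℝ)..1, s ^ m • k s)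
      (∑' x, F x) := by
    refine hsum.hasSum.prod_fiberwise fun m => ?_
    have : ∀ n ∉ Finset.range (m + 1), F (m, n) = 0 := by
      intro n hn
      simp only [hF]
      rw [legendreMoment_of_lt (by simpa using hn)]
      simp
    have hs := hasSum_sum_of_ne_finset_zero (L := SummationFilter.unconditional ℕ) this
    convert hs using 1
    rw [integral_pow_smul_eq_sum hk m (m + 1) (Nat.lt_succ_self m), Finset.smul_sum]
    refine Finset.sum_congr rfl fun n _ => ?_
    rw [← ofReal_smul_eq, smul_smul]
    push_cast
    rfl
  have h2 : HasSum (fun n : ℕ => ((2 * (n : ℂ) + 1) / 2 *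
        ∫ s in (-1 : ℝ)..1, Complex.exp (w * s) * ((legendreP n).eval s : ℝ)) • c n)
      (∑' x, F x) := by
    have hs' : HasSum (F ∘ Prod.swap) (∑' x, F x) :=
      ((Equiv.prodComm ℕ ℕ).hasSum_iff (f := F)).2 hsum.hasSum
    refine hs'.prod_fiberwise fun n => ?_
    have := ((hasSum_integral_exp_legendreP w n).mul_left ((2 * (n : ℂ) + 1) / 2)).smul_const (c n)
    refine hasSum_of_eq this fun m => ?_
    simp only [hF, Function.comp_apply, Prod.swap_prod_mk]
    congr 1
    ring
  rw [(hasSum_integral_exp_smul hk w).unique h1]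
  exact h2

end Series

/-! ### The free solution and its Legendre coefficients. -/

section FreeSolution

variable {𝔸 : Type*} [NormedRing 𝔸] [NormedAlgebra ℂ 𝔸]

/-- The solution `cos (lam x) - sin (lam x) J` of `J Y' = lam Y`, `Y(0) = 1`, where `J² = -1`. -/
noncomputable def freeSol (J : 𝔸) (lam : ℂ) (x : ℝ) : 𝔸 :=
  Complex.cos (lam * x) • (1 : 𝔸) - Complex.sin (lam * x) • J

/-- For `J² = -1`, the spectral projection of `J` to the eigenvalue `-i`. -/
noncomputable def specProj (J : 𝔸) : 𝔸 := (1 / 2 : ℂ) • (1 + Complex.I • J)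

variable (J : 𝔸)

theorem freeSol_eq (lam : ℂ) (x : ℝ) : freeSol J lam x =
    Complex.cos (lam * x) • (1 : 𝔸) - Complex.sin (lam * x) • J := rfl

theorem freeSol_zero_right (lam : ℂ) : freeSol J lam 0 = 1 := by simp [freeSol_eq]

theorem freeSol_mul_arg (lam : ℂ) (x s : ℝ) : freeSol J lam (x * s) = freeSol J (lam * x) s := by
  simp only [freeSol_eq, Complex.ofReal_mul, mul_assoc]

/-- Euler's formulas; this reduces algebra-valued integrals to scalar exponentials. -/
theorem freeSol_eq_exp (lam : ℂ) (x : ℝ) :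
    freeSol J lam x = Complex.exp (Complex.I * lam * x) • specProj J +
      Complex.exp (Complex.I * -lam * x) • specProj (-J) := by
  rw [freeSol_eq, Complex.cos, Complex.sin, show Complex.I * lam * x = lam * x * Complex.I by ring,
    show Complex.I * -lam * x = -(lam * x) * Complex.I by ring, specProj, specProj]
  module

theorem continuous_freeSol (lam : ℂ) : Continuous (freeSol J lam) := by
  rw [funext (freeSol_eq J lam)]
  fun_prop

theorem hasDerivAt_freeSol (hJ : J * J = -1) (lam : ℂ) (x : ℝ) :
    HasDerivAt (freeSol J lam) (-(lam • (J * freeSol J lam x))) x := by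
  have h0 : HasDerivAt (fun x : ℝ => lam * (x : ℂ)) lam x := by
    simpa using (Complex.ofRealCLM.hasDerivAt (x := x)).const_mul lam
  have h1 := (((Complex.hasDerivAt_cos _).comp x h0).smul_const (1 : 𝔸)).fun_sub
    (((Complex.hasDerivAt_sin _).comp x h0).smul_const J)
  convert! h1 using 1
  rw [freeSol_eq, mul_sub, mul_smul_comm, mul_smul_comm, hJ, mul_one]
  module

variable [CompleteSpace 𝔸]

theorem integral_const_mul_ring {f : ℝ → 𝔸} {a c : ℝ} (hf : IntervalIntegrable f volume a c)
    (A : 𝔸) : ∫ s in a..c, A * f s = A * ∫ s in a..c, f s :=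
  (ContinuousLinearMap.mul ℝ 𝔸 A).intervalIntegral_comp_comm hf

theorem integral_mul_const_ring {f : ℝ → 𝔸} {a c : ℝ} (hf : IntervalIntegrable f volume a c)
    (A : 𝔸) : ∫ s in a..c, f s * A = (∫ s in a..c, f s) * A :=
  ((ContinuousLinearMap.mul ℝ 𝔸).flip A).intervalIntegral_comp_comm hf

theorem integral_legendreP_freeSol_eq (z : ℂ) (n : ℕ) :
    ∫ s in (-1 : ℝ)..1, (legendreP n).eval s • freeSol J z s =
      (∫ s in (-1 : ℝ)..1, Complex.exp (Complex.I * z * s) * ((legendreP n).eval s : ℝ)) •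
        specProj J +
      (∫ s in (-1 : ℝ)..1, Complex.exp (Complex.I * -z * s) * ((legendreP n).eval s : ℝ)) •
        specProj (-J) := by
  have hP := continuous_eval_legendreP n
  rw [← intervalIntegral.integral_smul_const, ← intervalIntegral.integral_smul_const,
    ← intervalIntegral.integral_add]
  · refine intervalIntegral.integral_congr fun s _ => ?_
    rw [freeSol_eq_exp, ← ofReal_smul_eq, smul_add, smul_smul, smul_smul, mul_comm (Complex.exp (Complex.I * z * s)), mul_comm (Complex.exp (Complex.I * -z * s))]
  · exact Continuous.intervalIntegrable (by fun_prop) _ _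
  · exact Continuous.intervalIntegrable (by fun_prop) _ _

/-- By parity of `j_n` the two exponentials carry equal coefficients here, and `specProj J +
specProj (-J) = 1`. For odd index they are opposite, and the difference of the projections is `i J`.
-/
theorem integral_legendreP_even_freeSol (z : ℂ) (k : ℕ) :
    ∫ s in (-1 : ℝ)..1, (legendreP (2 * k)).eval s • freeSol J z s =
      (2 * ((-1) ^ k * sphBessel (2 * k) z)) • (1 : 𝔸) := by
  rw [integral_legendreP_freeSol_eq, integral_exp_legendreP, integral_exp_legendreP, sphBessel_neg,
    pow_mul Complex.I, Complex.I_sq, pow_mul (-1), neg_one_sq, one_pow, specProj, specProj]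
  module

theorem integral_legendreP_odd_freeSol (z : ℂ) (k : ℕ) :
    ∫ s in (-1 : ℝ)..1, (legendreP (2 * k + 1)).eval s • freeSol J z s =
      -((2 * ((-1) ^ k * sphBessel (2 * k + 1) z)) • J) := by
  rw [integral_legendreP_freeSol_eq, integral_exp_legendreP, integral_exp_legendreP, sphBessel_neg,
    pow_succ Complex.I, pow_mul Complex.I, Complex.I_sq, pow_succ (-1 : ℂ) (2 * k),
    pow_mul (-1 : ℂ) 2, neg_one_sq, one_pow, specProj, specProj]
  have hI : Complex.I * (Complex.I * (2 * ((-1) ^ k * sphBessel (2 * k + 1) z))) =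
      -(2 * ((-1) ^ k * sphBessel (2 * k + 1) z)) := by
    rw [← mul_assoc, Complex.I_mul_I, neg_one_mul]
  rw [← neg_smul, ← hI]
  module

theorem hasSum_legendre_freeSol J {k : ℝ → 𝔸} (hk : IntervalIntegrable k volume (-1) 1) (z : ℂ) :
    HasSum (fun n : ℕ => ((2 * (n : ℝ) + 1) / 2) •
        ((∫ s in (-1 : ℝ)..1, (legendreP n).eval s • k s) *
          ∫ s in (-1 : ℝ)..1, (legendreP n).eval s • freeSol J z s))
      (∫ s in (-1 : ℝ)..1, k s * freeSol J z s) := by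
  have h1 := ((hasSum_legendre_exp hk (Complex.I * z)).mul_right (specProj J)).add
    ((hasSum_legendre_exp hk (Complex.I * -z)).mul_right (specProj (-J)))
  have hi : ∀ w : ℂ, IntervalIntegrable (fun s : ℝ => Complex.exp (w * s) • k s)
      volume (-1) 1 := fun w =>
    hk.continuousOn_smul (by fun_prop : Continuous fun s : ℝ => Complex.exp (w * s)).continuousOn
  have e : ∫ s in (-1 : ℝ)..1, k s * freeSol J z s =
      (∫ s in (-1 : ℝ)..1, Complex.exp (Complex.I * z * s) • k s) * (specProj J) +
      (∫ s in (-1 : ℝ)..1, Complex.exp (Complex.I * -z * s) • k s) * (specProj (-J)) := by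
    rw [← integral_mul_const_ring (hi _), ← integral_mul_const_ring (hi _),
      ← intervalIntegral.integral_add]
    · refine intervalIntegral.integral_congr fun s _ => ?_
      rw [freeSol_eq_exp, mul_add, mul_smul_comm, mul_smul_comm, smul_mul_assoc, smul_mul_assoc]
    · exact (hi _).mul_const _
    · exact (hi _).mul_const _
  rw [e]
  refine hasSum_of_eq h1 fun n => ?_
  rw [integral_legendreP_freeSol_eq, ← ofReal_smul_eq, mul_add, smul_add, mul_smul_comm,
    mul_smul_comm, smul_smul, smul_smul, smul_mul_assoc, smul_mul_assoc]
  push_cast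
  rfl

end FreeSolution

/-! ### Integrals depending on a parameter. -/

section ParametricIntegral

variable {E : Type*} [NormedAddCommGroup E] [NormedSpace ℝ E]

theorem continuous_projIcc_val (a c : ℝ) (h : a ≤ c) :
    Continuous fun x : ℝ => (projIcc a c h x : ℝ) :=
  continuous_subtype_val.comp continuous_projIcc

theorem intervalIntegral_swap_of_continuous {h : ℝ → ℝ → E} (hh : Continuous (Function.uncurry h))
    (a c a' c' : ℝ) :
    ∫ s in a'..c', ∫ y in a..c, h y s = ∫ y in a..c, ∫ s in a'..c', h y s := by
  refine intervalIntegral_intervalIntegral_swap (F := fun s y => h y s) ?_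
  have hc : Continuous (Function.uncurry fun s y => h y s) := hh.comp continuous_swap
  exact (hc.continuousOn.integrableOn_compact (isCompact_uIcc.prod isCompact_uIcc)).mono_set
    (prod_mono uIoc_subset_uIcc uIoc_subset_uIcc)

variable [CompleteSpace E]

/-- Differentiation under the integral sign on a closed interval. -/
theorem hasDerivWithinAt_integral_of_continuousOn {g g' : ℝ → ℝ → E} {b a c : ℝ} (hac : a ≤ c)
    (hg' : ContinuousOn (Function.uncurry g') (Icc 0 b ×ˢ Icc a c))
    (hg : ∀ s ∈ Icc a c, ∀ x ∈ Icc (0 : ℝ) b,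
      HasDerivWithinAt (fun x => g x s) (g' x s) (Icc 0 b) x)
    (hg₀ : IntervalIntegrable (g 0) volume a c) {x : ℝ} (hx : x ∈ Icc (0 : ℝ) b) :
    HasDerivWithinAt (fun x => ∫ s in a..c, g x s) (∫ s in a..c, g' x s) (Icc 0 b) x := by
  have hb : 0 ≤ b := hx.1.trans hx.2
  -- Clamping both variables makes the derivative continuous on the whole plane. Then `g` is an
  -- integral of `h`, Fubini exchanges the integrals, and the fundamental theorem applies, endpoints
  -- included.
  set h : ℝ → ℝ → E := fun y s => g' (projIcc 0 b hb y) (projIcc a c hac s) with hh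
  have hcont : Continuous (Function.uncurry h) := by
    have : Continuous fun z : ℝ × ℝ => ((projIcc 0 b hb z.1 : ℝ), (projIcc a c hac z.2 : ℝ)) :=
      ((continuous_projIcc_val 0 b hb).comp continuous_fst).prodMk
        ((continuous_projIcc_val a c hac).comp continuous_snd)
    exact hg'.comp_continuous this fun z => ⟨Subtype.coe_prop _, Subtype.coe_prop _⟩
  have hh' : ∀ y ∈ Icc 0 b, ∀ s ∈ Icc a c, h y s = g' y s := by
    intro y hy s hs
    simp only [hh, projIcc_of_mem hb hy, projIcc_of_mem hac hs]
  have hcs : ∀ s, Continuous fun y => h y s := fun s =>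
    hcont.comp (continuous_id.prodMk continuous_const)
  have hcy : ∀ y, Continuous fun s => h y s := fun y =>
    hcont.comp (continuous_const.prodMk continuous_id)
  have hgi : ∀ y ∈ Icc 0 b, ∀ s ∈ Icc a c, g y s = g 0 s + ∫ t in (0 : ℝ)..y, h t s := by
    intro y hy s hs
    rw [intervalIntegral.integral_eq_sub_of_hasDerivAt_of_le (f := fun t => g t s) hy.1]
    · abel
    · exact fun t ht => ((hg s hs t ⟨ht.1, ht.2.trans hy.2⟩).continuousWithinAt).mono
        (Icc_subset_Icc_right hy.2)
    · intro t ht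
      have ht' : t ∈ Icc 0 b := ⟨ht.1.le, ht.2.le.trans hy.2⟩
      rw [hh' t ht' s hs]
      exact (hg s hs t ht').hasDerivAt (Icc_mem_nhds ht.1 (ht.2.trans_le hy.2))
    · exact (hcs s).intervalIntegrable _ _
  have hcI : Continuous fun y => ∫ s in a..c, h y s :=
    intervalIntegral.continuous_parametric_intervalIntegral_of_continuous' hcont a c
  have hF : ∀ y ∈ Icc 0 b, ∫ s in a..c, g y s =
      (∫ s in a..c, g 0 s) + ∫ t in (0 : ℝ)..y, ∫ s in a..c, h t s := by
    intro y hy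
    rw [← intervalIntegral_swap_of_continuous hcont, ← intervalIntegral.integral_add hg₀]
    · refine intervalIntegral.integral_congr fun s hs => ?_
      rw [uIcc_of_le hac] at hs
      exact hgi y hy s hs
    · refine Continuous.intervalIntegrable ?_ _ _
      exact intervalIntegral.continuous_parametric_intervalIntegral_of_continuous'
        (f := fun s t => h t s) (hcont.comp continuous_swap) 0 y
  have hd : HasDerivWithinAt
      (fun y => (∫ s in a..c, g 0 s) + ∫ t in (0 : ℝ)..y, ∫ s in a..c, h t s)
      (∫ s in a..c, h x s) (Icc 0 b) x :=
    ((hcI.integral_hasStrictDerivAt 0 x).hasDerivAt.const_add _).hasDerivWithinAt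
  have he : ∫ s in a..c, h x s = ∫ s in a..c, g' x s := by
    refine intervalIntegral.integral_congr fun s hs => ?_
    rw [uIcc_of_le hac] at hs
    exact hh' x hx s hs
  rw [← he]
  exact hd.congr hF (hF x hx)

end ParametricIntegral

/-! ### The Goursat kernel and its basic integral identity. -/

section Kernel

variable {𝔸 : Type*} [NormedRing 𝔸] [NormedAlgebra ℂ 𝔸]

theorem convex_triangle (b : ℝ) : Convex ℝ (triangle b) := by
  have : triangle b = ({z | 0 ≤ z.1} ∩ {z | z.1 ≤ b}) ∩ ({z | z.2 - z.1 ≤ 0} ∩ {z | -z.2 - z.1 ≤ 0}) := by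
    ext z
    simp only [triangle, mem_ofPred_eq, mem_inter_iff, abs_le]
    constructor
    · rintro ⟨h1, h2, h3, h4⟩
      exact ⟨⟨h1, h2⟩, by linarith, by linarith⟩
    · rintro ⟨⟨h1, h2⟩, h3, h4⟩
      exact ⟨h1, h2, by linarith, by linarith⟩
  rw [this]
  exact ((convex_halfSpace_ge (LinearMap.fst ℝ ℝ ℝ).isLinear 0).inter
    (convex_halfSpace_le (LinearMap.fst ℝ ℝ ℝ).isLinear b)).inter
    ((convex_halfSpace_le (LinearMap.snd ℝ ℝ ℝ - LinearMap.fst ℝ ℝ ℝ).isLinear 0).inter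
      (convex_halfSpace_le (-LinearMap.snd ℝ ℝ ℝ - LinearMap.fst ℝ ℝ ℝ).isLinear 0))

theorem uniqueDiffOn_triangle {b : ℝ} (hb : 0 < b) : UniqueDiffOn ℝ (triangle b) := by
  refine uniqueDiffOn_convex (convex_triangle b) ⟨(b / 2, 0), ?_⟩
  rw [mem_interior]
  refine ⟨{z : ℝ × ℝ | 0 < z.1} ∩ {z | z.1 < b} ∩ {z | |z.2| < z.1}, ?_, ?_, ?_⟩
  · rintro z ⟨⟨h1, h2⟩, h3⟩
    exact ⟨le_of_lt h1, le_of_lt h2, le_of_lt h3⟩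
  · exact ((isOpen_lt continuous_const continuous_fst).inter
      (isOpen_lt continuous_fst continuous_const)).inter
      (isOpen_lt (continuous_abs.comp continuous_snd) continuous_fst)
  · simp only [mem_inter_iff, mem_ofPred_eq, abs_zero]
    exact ⟨⟨by linarith, by linarith⟩, by linarith⟩

theorem mul_mem_triangle {b x s : ℝ} (hx : x ∈ Icc 0 b) (hs : s ∈ Icc (-1 : ℝ) 1) :
    (x, x * s) ∈ triangle b := by
  refine ⟨hx.1, hx.2, ?_⟩
  simp only [abs_mul, abs_of_nonneg hx.1]
  exact mul_le_of_le_one_right hx.1 (abs_le.2 hs)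

theorem continuousOn_comp_mul {E : Type*} [TopologicalSpace E] {b : ℝ} {f : ℝ × ℝ → E} (hf : ContinuousOn f (triangle b)) :
    ContinuousOn (fun z : ℝ × ℝ => f (z.1, z.1 * z.2)) (Icc 0 b ×ˢ Icc (-1) 1) :=
  hf.comp (continuous_fst.prodMk (continuous_fst.mul continuous_snd)).continuousOn
    fun _ hz => mul_mem_triangle hz.1 hz.2

theorem continuousOn_comp_mul_right {E : Type*} [TopologicalSpace E] {b : ℝ} {f : ℝ × ℝ → E} (hf : ContinuousOn f (triangle b)) {x : ℝ}
    (hx : x ∈ Icc 0 b) : ContinuousOn (fun s : ℝ => f (x, x * s)) (Icc (-1) 1) :=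
  hf.comp (continuous_const.prodMk (continuous_const.mul continuous_id)).continuousOn
    fun _ hs => mul_mem_triangle hx hs

/-- The Goursat problem for a transmutation kernel, in a Banach algebra with an element `J`. -/
structure IsGoursatKernel (J : 𝔸) (b : ℝ) (Q : ℝ → 𝔸) (K : ℝ → ℝ → 𝔸) : Prop where
  contDiffOn : ContDiffOn ℝ 1 (Function.uncurry K) (triangle b)
  pde : ∀ z ∈ triangle b,
    J * fderivWithin ℝ (Function.uncurry K) (triangle b) z (1, 0)
      + fderivWithin ℝ (Function.uncurry K) (triangle b) z (0, 1) * J = -(Q z.1 * K z.1 z.2)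
  diag : ∀ x ∈ Icc (0 : ℝ) b, J * K x x - K x x * J = -Q x
  antidiag : ∀ x ∈ Icc (0 : ℝ) b, J * K x (-x) + K x (-x) * J = 0

namespace IsGoursatKernel

variable {J : 𝔸} {b : ℝ} {Q : ℝ → 𝔸} {K : ℝ → ℝ → 𝔸}

theorem continuousOn_fderivWithin (hb : 0 < b) (hK : IsGoursatKernel J b Q K) (v : ℝ × ℝ) :
    ContinuousOn (fun z => fderivWithin ℝ (Function.uncurry K) (triangle b) z v) (triangle b) :=
  (hK.contDiffOn.continuousOn_fderivWithin (uniqueDiffOn_triangle hb) le_rfl).clm_apply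
    continuousOn_const

theorem hasFDerivWithinAt (hK : IsGoursatKernel J b Q K) {z : ℝ × ℝ} (hz : z ∈ triangle b) :
    HasFDerivWithinAt (Function.uncurry K)
      (fderivWithin ℝ (Function.uncurry K) (triangle b) z) (triangle b) z :=
  ((hK.contDiffOn.differentiableOn one_ne_zero) z hz).hasFDerivWithinAt

theorem hasDerivWithinAt_left (hK : IsGoursatKernel J b Q K) {x s : ℝ} (hx : x ∈ Icc 0 b)
    (hs : s ∈ Icc (-1 : ℝ) 1) :
    HasDerivWithinAt (fun x => K x (x * s))
      (fderivWithin ℝ (Function.uncurry K) (triangle b) (x, x * s) (1, 0) +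
        s • fderivWithin ℝ (Function.uncurry K) (triangle b) (x, x * s) (0, 1)) (Icc 0 b) x := by
  have h1 : HasDerivWithinAt (fun x : ℝ => (x, x * s)) ((1 : ℝ), s) (Icc 0 b) x := by
    have := ((hasDerivAt_id x).prodMk ((hasDerivAt_id x).mul_const s)).hasDerivWithinAt (s := Icc 0 b)
    simpa using this
  have h2 := (hK.hasFDerivWithinAt (mul_mem_triangle hx hs)).comp_hasDerivWithinAt x h1
    fun y hy => mul_mem_triangle hy hs
  have e : ((1 : ℝ), s) = (1, 0) + s • ((0 : ℝ), (1 : ℝ)) := by simp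
  rw [e, map_add, map_smul] at h2
  exact h2

theorem hasDerivWithinAt_right (hK : IsGoursatKernel J b Q K) {x s : ℝ} (hx : x ∈ Icc 0 b)
    (hs : s ∈ Icc (-1 : ℝ) 1) :
    HasDerivWithinAt (fun s => K x (x * s))
      (x • fderivWithin ℝ (Function.uncurry K) (triangle b) (x, x * s) (0, 1)) (Icc (-1) 1) s := by
  have h1 : HasDerivWithinAt (fun s : ℝ => (x, x * s)) ((0 : ℝ), x) (Icc (-1) 1) s := by
    have := ((hasDerivAt_const s x).prodMk ((hasDerivAt_id s).const_mul x)).hasDerivWithinAt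
      (s := Icc (-1) 1)
    simpa using this
  have h2 := (hK.hasFDerivWithinAt (mul_mem_triangle hx hs)).comp_hasDerivWithinAt s h1
    fun y hy => mul_mem_triangle hx hy
  have e : ((0 : ℝ), x) = x • ((0 : ℝ), (1 : ℝ)) := by simp
  rw [e, map_smul] at h2
  exact h2

theorem continuousOn_right (hK : IsGoursatKernel J b Q K) {x : ℝ} (hx : x ∈ Icc 0 b) :
    ContinuousOn (fun s : ℝ => K x (x * s)) (Icc (-1) 1) :=
  continuousOn_comp_mul_right hK.contDiffOn.continuousOn hx

variable [CompleteSpace 𝔸]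

/-- The equation satisfied by the integrals of a kernel against smooth functions. -/
theorem hasDerivWithinAt_integral (hb : 0 < b) (hJ : J * J = -1) (hK : IsGoursatKernel J b Q K)
    {W W₁ W₂ : ℝ → ℝ → 𝔸} (hW : Continuous (Function.uncurry W))
    (hW₁ : Continuous (Function.uncurry W₁)) (hW₂ : Continuous (Function.uncurry W₂))
    (hd₁ : ∀ x s, HasDerivAt (fun x => W x s) (W₁ x s) x)
    (hd₂ : ∀ x s, HasDerivAt (fun s => W x s) (W₂ x s) s) {x : ℝ} (hx : x ∈ Icc 0 b) :
    HasDerivWithinAt (fun x => ∫ s in (-1 : ℝ)..1, x • (K x (x * s) * W x s))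
      (J * (Q x * (∫ s in (-1 : ℝ)..1, x • (K x (x * s) * W x s)) + Q x * W x 1
        - ∫ s in (-1 : ℝ)..1, (K x (x * s) * J * W₂ x s - s • (J * K x (x * s) * W₂ x s)
          + x • (J * K x (x * s) * W₁ x s)))) (Icc 0 b) x := by
  have h11 : (-1 : ℝ) ≤ 1 := by norm_num
  set K₁ : ℝ × ℝ → 𝔸 := fun z => fderivWithin ℝ (Function.uncurry K) (triangle b) z (1, 0) with hK₁
  set K₂ : ℝ × ℝ → 𝔸 := fun z => fderivWithin ℝ (Function.uncurry K) (triangle b) z (0, 1) with hK₂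
  have cK₁ : ContinuousOn K₁ (triangle b) := hK.continuousOn_fderivWithin hb _
  have cK₂ : ContinuousOn K₂ (triangle b) := hK.continuousOn_fderivWithin hb _
  have cK : ContinuousOn (Function.uncurry K) (triangle b) := hK.contDiffOn.continuousOn
  set g' : ℝ → ℝ → 𝔸 := fun x s => K x (x * s) * W x s +
    x • ((K₁ (x, x * s) + s • K₂ (x, x * s)) * W x s + K x (x * s) * W₁ x s) with hg'
  have hg : HasDerivWithinAt (fun x => ∫ s in (-1 : ℝ)..1, x • (K x (x * s) * W x s))
      (∫ s in (-1 : ℝ)..1, g' x s) (Icc 0 b) x := by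
    refine hasDerivWithinAt_integral_of_continuousOn h11 ?_ ?_ ?_ hx
    · have a1 := continuousOn_comp_mul cK
      have a2 := continuousOn_comp_mul cK₁
      have a3 := continuousOn_comp_mul cK₂
      have a4 := hW.continuousOn (s := Icc 0 b ×ˢ Icc (-1) 1)
      have a5 := hW₁.continuousOn (s := Icc 0 b ×ˢ Icc (-1) 1)
      exact (a1.mul a4).add (continuous_fst.continuousOn.smul
        (((a2.add (continuous_snd.continuousOn.smul a3)).mul a4).add (a1.mul a5)))
    · intro s hs y hy
      have h1 := (hK.hasDerivWithinAt_left hy hs).mul (hd₁ y s).hasDerivWithinAt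
      have h2 := (hasDerivWithinAt_id y (Icc 0 b)).smul h1
      refine h2.congr_deriv ?_
      simp only [hg', id, one_smul]
      rw [add_comm]
      rfl
    · simp
  refine hg.congr_deriv ?_
  -- the integrand of the total derivative
  set D : ℝ → 𝔸 := fun s => (J * K x (x * s) * W x s
      + s • (J * (x • K₂ (x, x * s)) * W x s + J * K x (x * s) * W₂ x s))
      - (x • K₂ (x, x * s) * J * W x s + K x (x * s) * J * W₂ x s) with hD
  have b1 : ContinuousOn (fun s => K x (x * s)) (Icc (-1) 1) := continuousOn_comp_mul_right cK hx
  have b2 : ContinuousOn (fun s => K₁ (x, x * s)) (Icc (-1) 1) :=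
    continuousOn_comp_mul_right cK₁ hx
  have b3 : ContinuousOn (fun s => K₂ (x, x * s)) (Icc (-1) 1) :=
    continuousOn_comp_mul_right cK₂ hx
  have b4 : ContinuousOn (fun s => W x s) (Icc (-1) 1) :=
    (hW.comp (continuous_const.prodMk continuous_id)).continuousOn
  have b5 : ContinuousOn (fun s => W₁ x s) (Icc (-1) 1) :=
    (hW₁.comp (continuous_const.prodMk continuous_id)).continuousOn
  have b6 : ContinuousOn (fun s => W₂ x s) (Icc (-1) 1) :=
    (hW₂.comp (continuous_const.prodMk continuous_id)).continuousOn
  have cD : ContinuousOn D (Icc (-1) 1) :=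
    (((continuousOn_const.mul b1).mul b4).add (continuousOn_id.smul (((continuousOn_const.mul
      (b3.const_smul x)).mul b4).add ((continuousOn_const.mul b1).mul b6)))).sub
      ((((b3.const_smul x).mul continuousOn_const).mul b4).add ((b1.mul continuousOn_const).mul b6))
  -- `D` is the derivative of `s J K W - K J W`. At `s = 1` the diagonal condition turns the bracket
  -- into `-Q W`; at `s = -1` the antidiagonal condition makes it vanish.
  have iD : ∫ s in (-1 : ℝ)..1, D s = -(Q x * W x 1) := by
    rw [intervalIntegral.integral_eq_sub_of_hasDerivAt_of_le
      (f := fun s => s • (J * K x (x * s) * W x s) - K x (x * s) * J * W x s) h11]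
    · have e1 := hK.diag x hx
      have e2 := hK.antidiag x hx
      have e3 : ∀ A C D E W₁ W₂ : 𝔸, ((1 : ℝ) • (A * W₁) - C * W₁) - ((-1 : ℝ) • (D * W₂) - E * W₂) =
          (A - C) * W₁ + (D + E) * W₂ := by
        intro A C D E W₁ W₂
        rw [one_smul, neg_one_smul]
        noncomm_ring
      simp only [mul_one, mul_neg]
      rw [e3, e1, e2, zero_mul, add_zero, neg_mul]
    · exact (continuousOn_id.smul ((continuousOn_const.mul b1).mul b4)).sub
        ((b1.mul continuousOn_const).mul b4)
    · intro s hs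
      have hs' := Ioo_subset_Icc_self hs
      have d1 : HasDerivAt (fun s => K x (x * s)) (x • K₂ (x, x * s)) s :=
        (hK.hasDerivWithinAt_right hx hs').hasDerivAt (Icc_mem_nhds hs.1 hs.2)
      have d2 := (d1.const_mul J).fun_mul (hd₂ x s)
      have d3 := (d1.mul_const J).fun_mul (hd₂ x s)
      refine (((hasDerivAt_id s).fun_smul d2).fun_sub d3).congr_deriv ?_
      simp only [hD, id, one_smul]
      abel
    · exact cD.intervalIntegrable_of_Icc h11
  have cg' : ContinuousOn (g' x) (Icc (-1) 1) :=
    (b1.mul b4).add (((((b2.add (continuousOn_id.smul b3))).mul b4).add (b1.mul b5)).const_smul x)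
  have ig' := cg'.intervalIntegrable_of_Icc h11 (μ := volume)
  have cKW : ContinuousOn (fun s => x • (K x (x * s) * W x s)) (Icc (-1) 1) :=
    (b1.mul b4).const_smul x
  have iKW := cKW.intervalIntegrable_of_Icc h11 (μ := volume)
  have cR : ContinuousOn (fun s => K x (x * s) * J * W₂ x s - s • (J * K x (x * s) * W₂ x s)
          + x • (J * K x (x * s) * W₁ x s)) (Icc (-1) 1) :=
    (((b1.mul continuousOn_const).mul b6).sub (continuousOn_id.smul
      ((continuousOn_const.mul b1).mul b6))).add (((continuousOn_const.mul b1).mul b5).const_smul x)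
  have iR := cR.intervalIntegrable_of_Icc h11 (μ := volume)
  -- The equation for `K` replaces `J K_x` by `-Q K - K_t J`. All remaining terms with `K_t` are
  -- then those occurring in `D`.
  have key : J * (∫ s in (-1 : ℝ)..1, g' x s) +
      Q x * (∫ s in (-1 : ℝ)..1, x • (K x (x * s) * W x s)) = -(Q x * W x 1) +
        ∫ s in (-1 : ℝ)..1, (K x (x * s) * J * W₂ x s - s • (J * K x (x * s) * W₂ x s)
          + x • (J * K x (x * s) * W₁ x s)) := by
    rw [← iD, ← integral_const_mul_ring ig', ← integral_const_mul_ring iKW,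
      ← intervalIntegral.integral_add (ig'.const_mul J) (iKW.const_mul (Q x)),
      ← intervalIntegral.integral_add (cD.intervalIntegrable_of_Icc h11) iR]
    refine intervalIntegral.integral_congr fun s hs => ?_
    rw [uIcc_of_le h11] at hs
    have hp : Q x * K x (x * s) = -(J * K₁ (x, x * s) + K₂ (x, x * s) * J) := by
      have := hK.pde (x, x * s) (mul_mem_triangle hx hs)
      rw [this, neg_neg]
    simp only [hg', hD, mul_smul_comm, smul_mul_assoc]
    rw [← mul_assoc (Q x), hp]
    simp only [mul_add, add_mul, mul_smul_comm, smul_mul_assoc, smul_add, neg_mul, smul_neg, mul_assoc, neg_add]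
    rw [smul_comm s x]
    abel
  have e : J * (∫ s in (-1 : ℝ)..1, g' x s) =
      -(Q x * (∫ s in (-1 : ℝ)..1, x • (K x (x * s) * W x s)) + Q x * W x 1
        - ∫ s in (-1 : ℝ)..1, (K x (x * s) * J * W₂ x s - s • (J * K x (x * s) * W₂ x s)
          + x • (J * K x (x * s) * W₁ x s))) := by
    rw [eq_sub_of_add_eq key]
    abel
  rw [← neg_eq_iff_eq_neg] at e
  rw [← e, mul_neg, ← mul_assoc, hJ, neg_one_mul, neg_neg]

end IsGoursatKernel

end Kernel

/-! ### The Dirac equation: uniqueness, transmutation, moments, variation of constants. -/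

section Solutions

variable {𝔸 : Type*} [NormedRing 𝔸] [NormedAlgebra ℂ 𝔸]

/-- Solutions of `J Y' + Q Y = lam Y` on `[0, b]`, where `J² = -1`, solved for the derivative. -/
def IsSolution (J : 𝔸) (b : ℝ) (Q : ℝ → 𝔸) (lam : ℂ) (Y : ℝ → 𝔸) : Prop :=
  ∀ x ∈ Icc (0 : ℝ) b, HasDerivWithinAt Y (J * (Q x * Y x) - lam • (J * Y x)) (Icc 0 b) x

variable {J : 𝔸} {b : ℝ} {Q : ℝ → 𝔸} {K : ℝ → ℝ → 𝔸}

theorem IsSolution.eqOn {lam : ℂ} {Y Z : ℝ → 𝔸} (hQ : ContinuousOn Q (Icc 0 b))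
    (hY : IsSolution J b Q lam Y) (hZ : IsSolution J b Q lam Z) (h0 : Y 0 = Z 0) :
    EqOn Y Z (Icc 0 b) := by
  obtain ⟨C, hC⟩ := isCompact_Icc.exists_bound_of_continuousOn hQ
  have hC0 : ∀ t ∈ Ico 0 b, 0 ≤ C := fun t ht =>
    (norm_nonneg _).trans (hC t (Ico_subset_Icc_self ht))
  refine ODE_solution_unique_of_mem_Icc_right (s := fun _ => univ)
    (v := fun t y => J * (Q t * y) - lam • (J * y))
    (K := Real.toNNReal (‖J‖ * C + ‖lam‖ * ‖J‖)) ?_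
    (fun t ht => (hY t ht).continuousWithinAt) ?_ (fun _ _ => mem_univ _)
    (fun t ht => (hZ t ht).continuousWithinAt) ?_ (fun _ _ => mem_univ _) h0
  · intro t ht
    refine (LipschitzWith.of_dist_le_mul fun y z => ?_).lipschitzOnWith
    have := hC0 t ht
    rw [Real.coe_toNNReal _ (by positivity), dist_eq_norm, dist_eq_norm]
    have e : J * (Q t * y) - lam • (J * y) - (J * (Q t * z) - lam • (J * z)) =
        J * (Q t * (y - z)) - lam • (J * (y - z)) := by
      simp only [mul_sub, smul_sub]; abel
    rw [e, add_mul]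
    refine (norm_sub_le _ _).trans (add_le_add ?_ ?_)
    · calc ‖J * (Q t * (y - z))‖ ≤ ‖J‖ * (‖Q t‖ * ‖y - z‖) :=
            (norm_mul_le _ _).trans (by gcongr; exact norm_mul_le _ _)
        _ ≤ ‖J‖ * (C * ‖y - z‖) := by gcongr; exact hC t (Ico_subset_Icc_self ht)
        _ = _ := by ring
    · rw [norm_smul, mul_assoc]
      gcongr
      exact norm_mul_le _ _
  · exact fun t ht => (hY t (Ico_subset_Icc_self ht)).mono_of_mem_nhdsWithin
      (Icc_mem_nhdsGE_of_mem ht)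
  · exact fun t ht => (hZ t (Ico_subset_Icc_self ht)).mono_of_mem_nhdsWithin
      (Icc_mem_nhdsGE_of_mem ht)

/-- The image of the free solution under the transmutation operator. -/
noncomputable def transmuted (J : 𝔸) (K : ℝ → ℝ → 𝔸) (lam : ℂ) (x : ℝ) : 𝔸 :=
  freeSol J lam x + ∫ s in (-1 : ℝ)..1, x • (K x (x * s) * freeSol J lam (x * s))

theorem transmuted_zero_right (lam : ℂ) : transmuted J K lam 0 = 1 := by
  simp [transmuted, freeSol_zero_right]

/-- The substitution `t = x s` that fixes the domain of integration; it also holds at `x = 0`. -/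
theorem integral_neg_self_eq (f : ℝ → 𝔸) (x : ℝ) :
    ∫ t in (-x)..x, f t = ∫ s in (-1 : ℝ)..1, x • f (x * s) := by
  have h := intervalIntegral.smul_integral_comp_mul_left f x (a := -1) (b := 1)
  rw [mul_neg_one, mul_one] at h
  rw [← h, ← intervalIntegral.integral_smul]

theorem transmuted_eq (lam : ℂ) (x : ℝ) :
    transmuted J K lam x = freeSol J lam x + ∫ t in (-x)..x, K x t * freeSol J lam t := by
  rw [transmuted, integral_neg_self_eq fun t => K x t * freeSol J lam t]

/-- The moments of a kernel, transported to `[-1, 1]`. -/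
noncomputable def kernelMoment (K : ℝ → ℝ → 𝔸) (R : Polynomial ℝ) (x : ℝ) : 𝔸 :=
  ∫ s in (-1 : ℝ)..1, R.eval s • K x (x * s)

namespace IsGoursatKernel

theorem intervalIntegrable_eval_smul (hK : IsGoursatKernel J b Q K) (R : Polynomial ℝ) {x : ℝ}
    (hx : x ∈ Icc 0 b) :
    IntervalIntegrable (fun s => R.eval s • K x (x * s)) volume (-1) 1 :=
  (R.continuous.continuousOn.smul (hK.continuousOn_right hx)).intervalIntegrable_of_Icc
    (by norm_num)

theorem kernelMoment_sub (hK : IsGoursatKernel J b Q K) (R S : Polynomial ℝ) {x : ℝ}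
    (hx : x ∈ Icc 0 b) :
    kernelMoment K (R - S) x = kernelMoment K R x - kernelMoment K S x := by
  unfold kernelMoment
  rw [← intervalIntegral.integral_sub (hK.intervalIntegrable_eval_smul R hx)
    (hK.intervalIntegrable_eval_smul S hx)]
  simp only [Polynomial.eval_sub, sub_smul]

theorem continuousOn_kernelMoment (hK : IsGoursatKernel J b Q K) (R : Polynomial ℝ) :
    ContinuousOn (kernelMoment K R) (Icc 0 b) := by
  rcases lt_or_ge b 0 with hb | hb
  · simp [Icc_eq_empty_of_lt hb]
  have h11 : (-1 : ℝ) ≤ 1 := by norm_num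
  have hc : ContinuousOn (fun z : ℝ × ℝ => R.eval z.2 • K z.1 (z.1 * z.2))
      (Icc 0 b ×ˢ Icc (-1) 1) :=
    (R.continuous.comp continuous_snd).continuousOn.smul
      (continuousOn_comp_mul hK.contDiffOn.continuousOn)
  have hp : Continuous fun z : ℝ × ℝ =>
      ((projIcc 0 b hb z.1 : ℝ), (projIcc (-1 : ℝ) 1 h11 z.2 : ℝ)) :=
    ((continuous_projIcc_val 0 b hb).comp continuous_fst).prodMk
      ((continuous_projIcc_val (-1) 1 h11).comp continuous_snd)
  have hq := hc.comp_continuous hp fun z => ⟨Subtype.coe_prop _, Subtype.coe_prop _⟩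
  have hI := intervalIntegral.continuous_parametric_intervalIntegral_of_continuous'
    (μ := volume) (f := fun x s => (R.eval (projIcc (-1 : ℝ) 1 h11 s : ℝ)) •
      K (projIcc 0 b hb x) ((projIcc 0 b hb x : ℝ) * (projIcc (-1 : ℝ) 1 h11 s : ℝ))) hq (-1) 1
  refine hI.continuousOn.congr fun x hx => ?_
  refine intervalIntegral.integral_congr fun s hs => ?_
  rw [uIcc_of_le h11] at hs
  simp only [projIcc_of_mem hb hx, projIcc_of_mem h11 hs]

end IsGoursatKernel

/-- The inverse of a fundamental solution for `lam = 0`, by means of an involution `τ`. -/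
theorem IsSolution.involution_mul {V : ℝ → 𝔸} (hJ : J * J = -1) (hV : IsSolution J b Q 0 V)
    (hV0 : V 0 = 1) (τ : 𝔸 →L[ℝ] 𝔸) (hτ : ∀ a c, τ (a * c) = τ c * τ a) (hτ1 : τ 1 = 1)
    (hτJ : τ J = -J) (hτQ : ∀ x, τ (Q x) = Q x) {x : ℝ} (hx : x ∈ Icc 0 b) :
    -(J * τ (V x) * J) * V x = 1 := by
  -- A Wronskian: `V' = J Q V` gives `τ(V)' = -τ(V) Q J`, and `J² = -1` makes the two product-rule
  -- terms cancel. The constant value is `J`, taken at `0`.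
  have hd : ∀ y ∈ Icc 0 b, HasDerivWithinAt (fun y => τ (V y) * J * V y) 0 (Icc 0 b) y := by
    intro y hy
    have h1 := hV y hy
    rw [zero_smul, sub_zero] at h1
    have h2 := ((τ.hasFDerivAt.comp_hasDerivWithinAt y h1).mul_const J).fun_mul h1
    refine h2.congr_deriv ?_
    rw [hτ, hτ, hτJ, hτQ]
    simp only [Function.comp_apply, mul_neg, neg_mul, mul_assoc]
    rw [← mul_assoc J J, ← mul_assoc J J, hJ]
    simp
  have hc : τ (V x) * J * V x = τ (V 0) * J * V 0 :=
    constant_of_has_deriv_right_zero (f := fun y => τ (V y) * J * V y)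
      (fun y hy => (hd y hy).continuousWithinAt)
      (fun y hy => (hd y (Ico_subset_Icc_self hy)).mono_of_mem_nhdsWithin
        (Icc_mem_nhdsGE_of_mem hy)) x hx
  rw [hV0, hτ1, one_mul, mul_one] at hc
  rw [neg_mul, mul_assoc, mul_assoc, ← mul_assoc (τ (V x)), hc, hJ, neg_neg]

variable [CompleteSpace 𝔸]

theorem IsGoursatKernel.isSolution_transmuted (hb : 0 < b) (hJ : J * J = -1)
    (hK : IsGoursatKernel J b Q K) (lam : ℂ) : IsSolution J b Q lam (transmuted J K lam) := by
  intro x hx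
  have hc := continuous_freeSol J lam
  have hm : Continuous fun z : ℝ × ℝ => freeSol J lam (z.1 * z.2) :=
    hc.comp (continuous_fst.mul continuous_snd)
  have h := hK.hasDerivWithinAt_integral hb hJ (W := fun x s => freeSol J lam (x * s))
    (W₁ := fun x s => s • (-(lam • (J * freeSol J lam (x * s)))))
    (W₂ := fun x s => x • (-(lam • (J * freeSol J lam (x * s))))) hm
    (continuous_snd.smul ((continuous_const.mul hm).const_smul lam).neg)
    (continuous_fst.smul ((continuous_const.mul hm).const_smul lam).neg)
    (fun x s => HasDerivAt.scomp (h := fun x => x * s) x (hasDerivAt_freeSol J hJ lam (x * s)) (by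
      simpa using (hasDerivAt_id x).mul_const s))
    (fun x s => HasDerivAt.scomp (h := fun s => x * s) s (hasDerivAt_freeSol J hJ lam (x * s)) (by
      simpa using (hasDerivAt_id s).const_mul x)) hx
  -- The free solution depends on `x s` only, so the terms with `s ∂_s` and `x ∂_x` cancel; `J² =
  -- -1` in the remaining one yields `lam`.
  have e : ∫ s in (-1 : ℝ)..1, (K x (x * s) * J * (x • (-(lam • (J * freeSol J lam (x * s)))))
        - s • (J * K x (x * s) * (x • (-(lam • (J * freeSol J lam (x * s))))))
        + x • (J * K x (x * s) * (s • (-(lam • (J * freeSol J lam (x * s))))))) =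
      lam • ∫ s in (-1 : ℝ)..1, x • (K x (x * s) * freeSol J lam (x * s)) := by
    rw [← intervalIntegral.integral_smul]
    refine intervalIntegral.integral_congr fun s _ => ?_
    simp only [mul_smul_comm, mul_neg, smul_neg]
    rw [mul_assoc (K x (x * s)) J, ← mul_assoc J J, hJ, smul_comm s x, smul_comm lam x]
    simp
  rw [e] at h
  refine ((hasDerivAt_freeSol J hJ lam x).hasDerivWithinAt.add h).congr_deriv ?_
  rw [transmuted, mul_one]
  simp only [mul_add, mul_sub, mul_smul_comm, smul_add]
  abel

namespace IsGoursatKernel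

/-- The basic identity with the test function `R(s) · 1`, independent of `x`. Vanishing of `R` at
`1` removes the inhomogeneity `Q W(x, 1)`. -/
theorem hasDerivWithinAt_smul_kernelMoment (hb : 0 < b) (hJ : J * J = -1)
    (hK : IsGoursatKernel J b Q K) {R : Polynomial ℝ} (hR : R.eval 1 = 0) {x : ℝ}
    (hx : x ∈ Icc 0 b) :
    HasDerivWithinAt (fun x => x • kernelMoment K R x)
      (J * (Q x * (x • kernelMoment K R x) - (kernelMoment K R.derivative x * J -
        J * kernelMoment K (Polynomial.X * R.derivative) x))) (Icc 0 b) x := by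
  have h := hK.hasDerivWithinAt_integral hb hJ (W := fun _ s => R.eval s • (1 : 𝔸))
    (W₁ := fun _ _ => 0) (W₂ := fun _ s => R.derivative.eval s • (1 : 𝔸))
    ((R.continuous.comp continuous_snd).smul continuous_const) continuous_const
    ((R.derivative.continuous.comp continuous_snd).smul continuous_const)
    (fun x s => hasDerivAt_const x _) (fun x s => (R.hasDerivAt s).smul_const _) hx
  have e1 : ∀ x : ℝ, ∫ s in (-1 : ℝ)..1, x • (K x (x * s) * R.eval s • (1 : 𝔸)) =
      x • kernelMoment K R x := by
    intro x
    rw [kernelMoment, ← intervalIntegral.integral_smul]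
    simp only [mul_smul_comm, mul_one]
  have e2 : ∫ s in (-1 : ℝ)..1, (K x (x * s) * J * R.derivative.eval s • (1 : 𝔸) -
        s • (J * K x (x * s) * R.derivative.eval s • (1 : 𝔸)) + x • (J * K x (x * s) * 0)) =
      kernelMoment K R.derivative x * J - J * kernelMoment K (Polynomial.X * R.derivative) x := by
    have i1 := hK.intervalIntegrable_eval_smul R.derivative hx
    have i2 := hK.intervalIntegrable_eval_smul (Polynomial.X * R.derivative) hx
    rw [kernelMoment, kernelMoment, ← integral_mul_const_ring i1, ← integral_const_mul_ring i2,
      ← intervalIntegral.integral_sub (i1.mul_const J) (i2.const_mul J)]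
    refine intervalIntegral.integral_congr fun s _ => ?_
    simp [mul_smul]
  simp only [e1, e2] at h
  simp only [hR, zero_smul, mul_zero, add_zero] at h
  exact h

/-- The derivative of the weight `x^(n+1)` contributes `(n+1) R`, which combines with the moment of
`X R'` into that of `c A`. -/
theorem hasDerivWithinAt_pow_smul_kernelMoment (hb : 0 < b) (hJ : J * J = -1)
    (hK : IsGoursatKernel J b Q K) {R P A : Polynomial ℝ} {n : ℕ} {c : ℝ} (hR : R.eval 1 = 0)
    (hP : R.derivative = Polynomial.C c * P)
    (hA : Polynomial.X * R.derivative - Polynomial.C ((n : ℝ) + 1) * R = Polynomial.C c * A) {x : ℝ}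
    (hx : x ∈ Icc 0 b) :
    HasDerivWithinAt (fun x => x ^ (n + 1) • (x • kernelMoment K R x))
      (J * (Q x * (x ^ (n + 1) • (x • kernelMoment K R x))) -
        J * ((c * x ^ (n + 1)) • (kernelMoment K P x * J - J * kernelMoment K A x)))
      (Icc 0 b) x := by
  have hC : ∀ (a : ℝ) (S : Polynomial ℝ), kernelMoment K (Polynomial.C a * S) x =
      a • kernelMoment K S x := by
    intro a S
    rw [kernelMoment, kernelMoment, ← intervalIntegral.integral_smul]
    simp [mul_smul]
  have h := (hasDerivAt_pow (n + 1) x).hasDerivWithinAt (s := Icc 0 b) |>.fun_smul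
    (hK.hasDerivWithinAt_smul_kernelMoment hb hJ hR hx)
  have h1 := hK.kernelMoment_sub (Polynomial.X * R.derivative) (Polynomial.C ((n : ℝ) + 1) * R) hx
  rw [hA, hC, hC, eq_sub_iff_add_eq] at h1
  refine h.congr_deriv ?_
  rw [← h1, hP, hC]
  have hm : kernelMoment K R x = -(J * (J * kernelMoment K R x)) := by
    rw [← mul_assoc, hJ, neg_one_mul, neg_neg]
  simp only [Nat.add_sub_cancel]
  push_cast
  simp only [mul_add, smul_add, mul_smul_comm, smul_mul_assoc, sub_eq_add_neg, neg_add, neg_neg, mul_neg,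
    smul_neg, smul_smul, pow_succ]
  generalize J * (J * kernelMoment K R x) = a at hm ⊢
  rw [hm]
  module

end IsGoursatKernel

/-- Variation of constants. -/
theorem IsSolution.variation_of_constants {V W Y H : ℝ → 𝔸} (hJ : J * J = -1)
    (hV : IsSolution J b Q 0 V) (τ : 𝔸 →L[ℝ] 𝔸) (hτ : ∀ a c, τ (a * c) = τ c * τ a)
    (hτJ : τ J = -J) (hτQ : ∀ x, τ (Q x) = Q x)
    (hW : ∀ x ∈ Icc 0 b, W x = -(J * τ (V x) * J)) (hVW : ∀ x ∈ Icc 0 b, V x * W x = 1)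
    (hH : ContinuousOn H (Icc 0 b))
    (hY : ∀ x ∈ Icc 0 b, HasDerivWithinAt Y (J * (Q x * Y x) - J * H x) (Icc 0 b) x)
    (hY0 : Y 0 = 0) {x : ℝ} (hx : x ∈ Icc 0 b) :
    Y x = V x * ∫ t in (0 : ℝ)..x, W t * (-J) * H t := by
  -- The explicit formula for the inverse is differentiated through `τ`, so inversion itself need
  -- not be.
  have hW' : ∀ y ∈ Icc 0 b, HasDerivWithinAt W (-(W y * J * Q y)) (Icc 0 b) y := by
    intro y hy
    have h1 := hV y hy
    rw [zero_smul, sub_zero] at h1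
    have h2 := (((τ.hasFDerivAt.comp_hasDerivWithinAt y h1).const_mul J).mul_const J).fun_neg
    refine (h2.congr (fun z hz => hW z hz) (hW y hy)).congr_deriv ?_
    rw [hτ, hτ, hτJ, hτQ, hW y hy]
    simp only [mul_neg, neg_mul, mul_assoc, neg_neg]
    rw [hJ, ← mul_assoc J J, hJ]
    simp
  have hd : ∀ y ∈ Icc 0 b,
      HasDerivWithinAt (fun y => W y * Y y) (W y * (-J) * H y) (Icc 0 b) y := by
    intro y hy
    refine ((hW' y hy).fun_mul (hY y hy)).congr_deriv ?_
    simp only [mul_neg, neg_mul, mul_assoc, mul_sub]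
    abel
  have hWc : ContinuousOn W (Icc 0 b) := fun y hy => (hW' y hy).continuousWithinAt
  have hc : ContinuousOn (fun y => W y * (-J) * H y) (Icc 0 b) :=
    (hWc.mul continuousOn_const).mul hH
  rw [intervalIntegral.integral_eq_sub_of_hasDerivAt_of_le (f := fun y => W y * Y y) hx.1]
  · rw [hY0, mul_zero, sub_zero, ← mul_assoc, hVW x hx, one_mul]
  · exact fun y hy => ((hd y ⟨hy.1, hy.2.trans hx.2⟩).continuousWithinAt).mono
      (Icc_subset_Icc_right hx.2)
  · exact fun y hy => (hd y ⟨hy.1.le, hy.2.le.trans hx.2⟩).hasDerivAt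
      (Icc_mem_nhds hy.1 (hy.2.trans_le hx.2))
  · exact (hc.mono (Icc_subset_Icc_right hx.2)).intervalIntegrable_of_Icc hx.1

end Solutions

/-! ### Existence of the kernel: a Volterra equation in characteristic coordinates. -/

section Existence

theorem hasDerivAt_integral_of_continuous {E : Type*} [NormedAddCommGroup E] [NormedSpace ℝ E]
    [CompleteSpace E] {h h' : ℝ → ℝ → E}
    (hc : Continuous (Function.uncurry h)) (hc' : Continuous (Function.uncurry h'))
    (hd : ∀ s w, HasDerivAt (fun w => h s w) (h' s w) w) (v u : ℝ) :
    HasDerivAt (fun u => ∫ s in (0 : ℝ)..v, h s u) (∫ s in (0 : ℝ)..v, h' s u) u := by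
  have hs' : Continuous (Function.uncurry fun w s => h' s w) := hc'.comp continuous_swap
  have e : ∀ u, ∫ s in (0 : ℝ)..v, h s u =
      (∫ s in (0 : ℝ)..v, h s 0) + ∫ w in (0 : ℝ)..u, ∫ s in (0 : ℝ)..v, h' s w := by
    intro u
    rw [← intervalIntegral_swap_of_continuous hs', ← intervalIntegral.integral_add]
    · refine intervalIntegral.integral_congr fun s _ => ?_
      have hcs : Continuous fun w => h' s w := hc'.comp (continuous_const.prodMk continuous_id)
      rw [intervalIntegral.integral_eq_sub_of_hasDerivAt (fun w _ => hd s w)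
        (hcs.intervalIntegrable _ _)]
      abel
    · exact (hc.comp (continuous_id.prodMk continuous_const)).intervalIntegrable _ _
    · exact (intervalIntegral.continuous_parametric_intervalIntegral_of_continuous'
        hc' 0 u).intervalIntegrable _ _
  rw [funext e]
  have hcI : Continuous fun w => ∫ s in (0 : ℝ)..v, h' s w :=
    intervalIntegral.continuous_parametric_intervalIntegral_of_continuous' hs' 0 v
  exact (hcI.integral_hasStrictDerivAt 0 u).hasDerivAt.const_add _

variable {𝔸 : Type*} [NormedRing 𝔸] [NormedAlgebra ℂ 𝔸]

/-- The successive approximations for `F(u, v) = g(u) + ∫_0^v G(s + u) F(s, u) ds`. -/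
noncomputable def picard (G g : ℝ → 𝔸) : ℕ → ℝ → ℝ → 𝔸
  | 0 => fun u _ => g u
  | n + 1 => fun u v => ∫ s in (0 : ℝ)..v, G (s + u) * picard G g n s u

theorem continuous_picard {G g : ℝ → 𝔸} (hG : Continuous G) (hg : Continuous g) (n : ℕ) :
    Continuous (Function.uncurry (picard G g n)) := by
  induction n with
  | zero => exact hg.comp continuous_fst
  | succ n ih =>
    have h : Continuous (Function.uncurry fun (z : ℝ × ℝ) (s : ℝ) =>
        G (s + z.1) * picard G g n s z.1) :=
      (hG.comp (continuous_snd.add (continuous_fst.comp continuous_fst))).mul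
        (ih.comp (continuous_snd.prodMk (continuous_fst.comp continuous_fst)))
    exact intervalIntegral.continuous_parametric_intervalIntegral_of_continuous h continuous_snd

/-- Each iteration swaps the arguments, so the bound must be symmetric in them: powers of `|u| +
|v|` survive the induction. -/
theorem norm_picard_le {G g : ℝ → 𝔸} (hG : Continuous G) (hg : Continuous g) {R M C : ℝ}
    (hM : ∀ x ∈ Icc (-(2 * R)) (2 * R), ‖G x‖ ≤ M) (hC : ∀ x ∈ Icc (-R) R, ‖g x‖ ≤ C) (n : ℕ)
    {u v : ℝ} (hu : |u| ≤ R) (hv : |v| ≤ R) :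
    ‖picard G g n u v‖ ≤ C * M ^ n * (|u| + |v|) ^ n / (n ! : ℝ) := by
  have hR : 0 ≤ R := (abs_nonneg _).trans hu
  have hM0 : 0 ≤ M := (norm_nonneg _).trans (hM 0 ⟨by linarith, by linarith⟩)
  induction n generalizing u v with
  | zero => simpa [picard] using hC u (abs_le.1 hu)
  | succ n ih =>
    have hpc := continuous_picard hG hg n
    -- Rescaling to `[0, 1]` avoids a case distinction on the sign of `v`.
    have e : picard G g (n + 1) u v =
        ∫ τ in (0 : ℝ)..1, v • (G (v * τ + u) * picard G g n (v * τ) u) := by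
      have h := intervalIntegral.smul_integral_comp_mul_left
        (fun s => G (s + u) * picard G g n s u) v (a := 0) (b := 1)
      rw [mul_zero, mul_one] at h
      rw [intervalIntegral.integral_smul, h, picard]
    have hb : ∫ τ in (0 : ℝ)..1, C * M ^ (n + 1) / (n ! : ℝ) * (|v| * (τ * |v| + |u|) ^ n) =
        C * M ^ (n + 1) / (n ! : ℝ) * (((|v| + |u|) ^ (n + 1) - |u| ^ (n + 1)) / (n + 1)) := by
      rw [intervalIntegral.integral_const_mul]
      congr 1
      rw [intervalIntegral.integral_eq_sub_of_hasDerivAt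
        (f := fun τ : ℝ => (τ * |v| + |u|) ^ (n + 1) / ((n : ℝ) + 1))]
      · rw [one_mul, zero_mul, zero_add, sub_div]
      · intro τ _
        have h1 : HasDerivAt (fun τ : ℝ => τ * |v| + |u|) |v| τ := by
          simpa using ((hasDerivAt_id τ).mul_const |v|).add_const |u|
        refine ((h1.fun_pow (n + 1)).div_const ((n : ℝ) + 1)).congr_deriv ?_
        simp only [Nat.add_sub_cancel]
        push_cast
        field_simp
      · exact Continuous.intervalIntegrable (by fun_prop) _ _
    have hC0 : 0 ≤ C := (norm_nonneg _).trans (hC 0 ⟨by linarith, by linarith⟩)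
    calc ‖picard G g (n + 1) u v‖
        ≤ ∫ τ in (0 : ℝ)..1, C * M ^ (n + 1) / (n ! : ℝ) * (|v| * (τ * |v| + |u|) ^ n) := by
          rw [e]
          refine intervalIntegral.norm_integral_le_of_norm_le zero_le_one
            (ae_of_all _ fun τ hτ => ?_) (Continuous.intervalIntegrable (by fun_prop) _ _)
          have hvτ : |v * τ| = τ * |v| := by rw [abs_mul, abs_of_pos hτ.1, mul_comm]
          have hvτ' : |v * τ| ≤ R := by
            rw [hvτ]
            exact (mul_le_of_le_one_left (abs_nonneg v) hτ.2).trans hv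
          have h1 : ‖G (v * τ + u)‖ ≤ M := by
            refine hM _ (abs_le.1 ?_)
            refine (abs_add_le _ _).trans ?_
            linarith
          have h2 := ih hvτ' hu
          rw [hvτ] at h2
          rw [norm_smul, Real.norm_eq_abs]
          calc |v| * ‖G (v * τ + u) * picard G g n (v * τ) u‖
              ≤ |v| * (M * (C * M ^ n * (τ * |v| + |u|) ^ n / (n ! : ℝ))) := by
                gcongr
                exact (norm_mul_le _ _).trans (by gcongr)
            _ = _ := by ring
      _ ≤ C * M ^ (n + 1) / (n ! : ℝ) * ((|u| + |v|) ^ (n + 1) / (n + 1)) := by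
          rw [hb, add_comm |v|]
          gcongr
          linarith [pow_nonneg (abs_nonneg u) (n + 1)]
      _ = _ := by
          rw [Nat.factorial_succ]
          push_cast
          field_simp

variable [CompleteSpace 𝔸]

theorem exists_volterra_solution {G g : ℝ → 𝔸} (hG : Continuous G) (hg : Continuous g) :
    ∃ F : ℝ → ℝ → 𝔸, Continuous (Function.uncurry F) ∧
      ∀ u v, F u v = g u + ∫ s in (0 : ℝ)..v, G (s + u) * F s u := by
  have hbd : ∀ R : ℝ, 0 ≤ R → ∃ M C : ℝ, 0 ≤ C ∧ (∀ x ∈ Icc (-(2 * R)) (2 * R), ‖G x‖ ≤ M) ∧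
      ∀ n u v, |u| ≤ R → |v| ≤ R → ‖picard G g n u v‖ ≤ C * ((M * (2 * R)) ^ n / (n ! : ℝ)) := by
    intro R hR
    obtain ⟨M, hM⟩ := isCompact_Icc.exists_bound_of_continuousOn
      (hG.continuousOn (s := Icc (-(2 * R)) (2 * R)))
    obtain ⟨C, hC⟩ := isCompact_Icc.exists_bound_of_continuousOn
      (hg.continuousOn (s := Icc (-R) R))
    have hM0 : 0 ≤ M := (norm_nonneg _).trans (hM 0 ⟨by linarith, by linarith⟩)
    have hC0 : 0 ≤ C := (norm_nonneg _).trans (hC 0 ⟨by linarith, by linarith⟩)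
    refine ⟨M, C, hC0, hM, fun n u v hu hv => (norm_picard_le hG hg hM hC n hu hv).trans ?_⟩
    rw [mul_pow, mul_assoc, mul_div_assoc]
    gcongr
    linarith
  have hsum : ∀ u v, Summable fun n => picard G g n u v := by
    intro u v
    obtain ⟨M, C, _, _, h⟩ := hbd (max |u| |v|) ((abs_nonneg u).trans (le_max_left _ _))
    exact Summable.of_norm_bounded ((Real.summable_pow_div_factorial _).mul_left C)
      fun n => h n u v (le_max_left _ _) (le_max_right _ _)
  refine ⟨fun u v => ∑' n, picard G g n u v, ?_, ?_⟩
  · rw [continuous_iff_continuousAt]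
    rintro ⟨u, v⟩
    set R := max |u| |v| + 1 with hR
    have hR0 : 0 ≤ R := by positivity
    obtain ⟨M, C, _, _, h⟩ := hbd R hR0
    set S : Set (ℝ × ℝ) := {z | |z.1| < R} ∩ {z | |z.2| < R} with hS
    have hSo : IsOpen S := (isOpen_lt (continuous_abs.comp continuous_fst) continuous_const).inter
      (isOpen_lt (continuous_abs.comp continuous_snd) continuous_const)
    have hcont : ContinuousOn (fun z : ℝ × ℝ => ∑' n, picard G g n z.1 z.2) S :=
      continuousOn_tsum (fun n => (continuous_picard hG hg n).continuousOn)
        ((Real.summable_pow_div_factorial _).mul_left C)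
        fun n z hz => h n z.1 z.2 (le_of_lt hz.1) (le_of_lt hz.2)
    refine hcont.continuousAt (hSo.mem_nhds ⟨?_, ?_⟩)
    · exact lt_of_le_of_lt (le_max_left |u| |v|) (lt_add_one _)
    · exact lt_of_le_of_lt (le_max_right |u| |v|) (lt_add_one _)
  · intro u v
    obtain ⟨M, C, hC0, hM, h⟩ := hbd (max |u| |v|) ((abs_nonneg u).trans (le_max_left _ _))
    have hint : HasSum (fun n => ∫ s in (0 : ℝ)..v, G (s + u) * picard G g n s u)
        (∫ s in (0 : ℝ)..v, G (s + u) * ∑' n, picard G g n s u) := by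
      refine intervalIntegral.hasSum_integral_of_dominated_convergence
        (fun n _ => M * (C * ((M * (2 * max |u| |v|)) ^ n / (n ! : ℝ)))) (fun n => ?_)
        (fun n => ae_of_all _ fun s hs => ?_) (ae_of_all _ fun s _ => ?_)
        intervalIntegrable_const (ae_of_all _ fun s _ => (hsum s u).hasSum.mul_left _)
      · have := (continuous_picard hG hg n).comp (continuous_id.prodMk (continuous_const (y := u)))
        exact ((hG.comp (continuous_id.add continuous_const)).mul this).aestronglyMeasurable
      · have hs' : |s| ≤ max |u| |v| := by
          have := abs_sub_left_of_mem_uIcc (uIoc_subset_uIcc hs)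
          rw [sub_zero, sub_zero] at this
          exact this.trans (le_max_right _ _)
        have h1 : ‖G (s + u)‖ ≤ M := by
          refine hM _ (abs_le.1 ((abs_add_le _ _).trans ?_))
          linarith [le_max_left |u| |v|]
        exact (norm_mul_le _ _).trans (mul_le_mul h1 (h n s u hs' (le_max_left _ _))
          (norm_nonneg _) ((norm_nonneg _).trans h1))
      · exact ((Real.summable_pow_div_factorial _).mul_left C).mul_left M
    have h1 : (fun n => ∫ s in (0 : ℝ)..v, G (s + u) * picard G g n s u) =
        fun n => picard G g (n + 1) u v := rfl
    beta_reduce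
    rw [(hsum u v).tsum_eq_zero_add, ← hint.tsum_eq, h1]
    rfl

/-- Solutions of the integral equation are continuously differentiable. -/
theorem exists_partials_of_volterra {G G' : ℝ → 𝔸} (hG : ∀ x, HasDerivAt G (G' x) x)
    (hG' : Continuous G') {F : ℝ → ℝ → 𝔸} (hF : Continuous (Function.uncurry F))
    (heq : ∀ u v, F u v = (1 / 2 : ℝ) • G u + ∫ s in (0 : ℝ)..v, G (s + u) * F s u) :
    ∃ F₁ : ℝ → ℝ → 𝔸, Continuous (Function.uncurry F₁) ∧
      (∀ u v, HasDerivAt (fun u => F u v) (F₁ u v) u) ∧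
      ∀ u v, HasDerivAt (fun v => F u v) (G (v + u) * F v u) v := by
  have hGc : Continuous G := continuous_iff_continuousAt.2 fun x => (hG x).continuousAt
  have hadd : Continuous fun z : ℝ × ℝ => G (z.1 + z.2) :=
    hGc.comp (continuous_fst.add continuous_snd)
  have hadd' : Continuous fun z : ℝ × ℝ => G' (z.1 + z.2) :=
    hG'.comp (continuous_fst.add continuous_snd)
  have hsw : Continuous fun z : ℝ × ℝ => F z.2 z.1 := hF.comp continuous_swap
  have hh : Continuous (Function.uncurry fun s u => G (s + u) * F s u) := hadd.mul hF
  have hh' : Continuous (Function.uncurry fun s u =>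
      G' (s + u) * F s u + G (s + u) * (G (u + s) * F u s)) := by
    have hadd2 : Continuous fun z : ℝ × ℝ => G (z.2 + z.1) := hadd.comp continuous_swap
    exact (hadd'.mul hF).add (hadd.mul (hadd2.mul hsw))
  have d2 : ∀ u v, HasDerivAt (fun v => F u v) (G (v + u) * F v u) v := by
    intro u v
    rw [funext (heq u)]
    have hc : Continuous fun s => G (s + u) * F s u :=
      hh.comp (continuous_id.prodMk continuous_const)
    exact (hc.integral_hasStrictDerivAt 0 v).hasDerivAt.const_add _
  -- Under the integral `u` is the second argument of `F`, where differentiability is already known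
  -- from `d2`; hence there is no circularity.
  refine ⟨fun u v => (1 / 2 : ℝ) • G' u + ∫ s in (0 : ℝ)..v,
    (G' (s + u) * F s u + G (s + u) * (G (u + s) * F u s)), ?_, ?_, d2⟩
  · refine ((hG'.comp continuous_fst).const_smul _).add ?_
    have hp : Continuous fun w : (ℝ × ℝ) × ℝ => (w.2, w.1.1) :=
      continuous_snd.prodMk (continuous_fst.comp continuous_fst)
    exact intervalIntegral.continuous_parametric_intervalIntegral_of_continuous
      (f := fun (z : ℝ × ℝ) s => G' (s + z.1) * F s z.1 + G (s + z.1) * (G (z.1 + s) * F z.1 s))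
      (hh'.comp hp) continuous_snd
  · intro u v
    rw [funext fun u => heq u v]
    refine ((hG u).const_smul _).add (hasDerivAt_integral_of_continuous hh hh' (fun s w => ?_) v u)
    exact (HasDerivAt.scomp (h := fun w => s + w) w (hG (s + w))
      ((hasDerivAt_id w).const_add s) |>.congr_deriv (one_smul _ _)).fun_mul (d2 s w)

theorem contDiff_one_of_partials {E : Type*} [NormedAddCommGroup E] [NormedSpace ℝ E]
    {F F₁ F₂ : ℝ → ℝ → E} (hF₁ : Continuous (Function.uncurry F₁))
    (hF₂ : Continuous (Function.uncurry F₂)) (d₁ : ∀ u v, HasDerivAt (fun u => F u v) (F₁ u v) u)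
    (d₂ : ∀ u v, HasDerivAt (fun v => F u v) (F₂ u v) v) :
    ContDiff ℝ 1 (Function.uncurry F) ∧
      ∀ u v, HasFDerivAt (Function.uncurry F)
        ((ContinuousLinearMap.fst ℝ ℝ ℝ).smulRight (F₁ u v) +
          (ContinuousLinearMap.snd ℝ ℝ ℝ).smulRight (F₂ u v)) (u, v) := by
  have cT : Continuous fun y : E => ContinuousLinearMap.toSpanSingleton ℝ y :=
    (ContinuousLinearMap.toSpanSingletonCLE (𝕜 := ℝ) (E := E)).continuous
  have hd : ∀ z : ℝ × ℝ, HasFDerivAt (Function.uncurry F)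
      ((ContinuousLinearMap.fst ℝ ℝ ℝ).smulRight (F₁ z.1 z.2) +
          (ContinuousLinearMap.snd ℝ ℝ ℝ).smulRight (F₂ z.1 z.2)) z := by
    intro z
    refine (hasStrictFDerivAt_uncurry_coprod (𝕜 := ℝ) (u := z) (f := F)
      (f₁ := fun u v => ContinuousLinearMap.toSpanSingleton ℝ (F₁ u v))
      (f₂ := fun u v => ContinuousLinearMap.toSpanSingleton ℝ (F₂ u v))
      (Eventually.of_forall fun w => (d₁ w.1 w.2).hasFDerivAt)
      (Eventually.of_forall fun w => (d₂ w.1 w.2).hasFDerivAt)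
      (cT.comp hF₁).continuousAt (cT.comp hF₂).continuousAt).hasFDerivAt.congr_fderiv ?_
    ext <;> simp [Function.HasUncurry.uncurry]
  refine ⟨contDiff_one_iff_hasFDerivAt.2 ⟨_, ?_, hd⟩, fun u v => hd (u, v)⟩
  exact (((ContinuousLinearMap.smulRightL ℝ (ℝ × ℝ) E
    (ContinuousLinearMap.fst ℝ ℝ ℝ)).continuous.comp hF₁).add
    ((ContinuousLinearMap.smulRightL ℝ (ℝ × ℝ) E
    (ContinuousLinearMap.snd ℝ ℝ ℝ)).continuous.comp hF₂))

/-- Existence for the Goursat problem, by characteristic coordinates. -/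
theorem exists_isGoursatKernel {J : 𝔸} (hJ : J * J = -1) {b : ℝ} (hb : 0 < b) {Q Q' : ℝ → 𝔸}
    (hQ : ∀ x, HasDerivAt Q (Q' x) x) (hQ' : Continuous Q') (hJQ : ∀ x, J * Q x = -(Q x * J)) :
    ∃ K, IsGoursatKernel J b Q K := by
  have hQc : Continuous Q := continuous_iff_continuousAt.2 fun x => (hQ x).continuousAt
  obtain ⟨F, hF, heq⟩ := exists_volterra_solution (G := fun x => J * Q x)
    (g := fun x => (1 / 2 : ℝ) • (J * Q x))
    (continuous_const.mul hQc) ((continuous_const.mul hQc).const_smul _)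
  obtain ⟨F₁, hF₁, d₁, d₂⟩ := exists_partials_of_volterra (fun x => (hQ x).const_mul J)
    (continuous_const.mul hQ') hF heq
  obtain ⟨hFC, hFd⟩ := contDiff_one_of_partials hF₁ (F₂ := fun u v => J * Q (v + u) * F v u)
    (((continuous_const.mul hQc).comp (continuous_snd.add continuous_fst)).mul
      (hF.comp continuous_swap)) d₁ d₂
  have hF0 : ∀ x, F x 0 = (1 / 2 : ℝ) • (J * Q x) := by
    intro x
    rw [heq, intervalIntegral.integral_same, add_zero]
  have hJJ : ∀ A : 𝔸, J * (J * A) = -A := fun A => by rw [← mul_assoc, hJ, neg_one_mul]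
  have hJQ' : ∀ (x : ℝ) (A : 𝔸), J * (Q x * A) = -(Q x * (J * A)) := fun x A => by
    rw [← mul_assoc, hJQ, neg_mul, mul_assoc]
  set L : ℝ × ℝ →L[ℝ] ℝ × ℝ :=
    ((1 / 2 : ℝ) • (ContinuousLinearMap.fst ℝ ℝ ℝ + ContinuousLinearMap.snd ℝ ℝ ℝ)).prod
      ((1 / 2 : ℝ) • (ContinuousLinearMap.fst ℝ ℝ ℝ - ContinuousLinearMap.snd ℝ ℝ ℝ)) with hL
  set L' : ℝ × ℝ →L[ℝ] ℝ × ℝ :=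
    ((1 / 2 : ℝ) • (ContinuousLinearMap.fst ℝ ℝ ℝ - ContinuousLinearMap.snd ℝ ℝ ℝ)).prod
      ((1 / 2 : ℝ) • (ContinuousLinearMap.fst ℝ ℝ ℝ + ContinuousLinearMap.snd ℝ ℝ ℝ)) with hL'
  have hLv : ∀ x t, L (x, t) = ((1 / 2) * (x + t), (1 / 2) * (x - t)) := fun x t => rfl
  have hLv' : ∀ x t, L' (x, t) = ((1 / 2) * (x - t), (1 / 2) * (x + t)) := fun x t => rfl
  -- `P` projects onto the part anticommuting with `J`, and `P'` onto the commuting part.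
  set P : 𝔸 →L[ℝ] 𝔸 := (1 / 2 : ℝ) • (ContinuousLinearMap.id ℝ 𝔸 +
    ContinuousLinearMap.mulLeftRight ℝ 𝔸 J J) with hP
  set P' : 𝔸 →L[ℝ] 𝔸 := (1 / 2 : ℝ) • (ContinuousLinearMap.id ℝ 𝔸 -
    ContinuousLinearMap.mulLeftRight ℝ 𝔸 J J) with hP'
  have hPv : ∀ A, P A = (1 / 2 : ℝ) • (A + J * A * J) := fun A => rfl
  have hPv' : ∀ A, P' A = (1 / 2 : ℝ) • (A - J * A * J) := fun A => rfl
  -- With `ξ = (x+t)/2` and `η = (x-t)/2`, the equation says `∂_η K^a = J Q K^c` and `∂_ξ K^c = J Q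
  -- K^a` for the anticommuting and commuting parts. Taking `F(ξ,η)` for one and `F(η,ξ)` for the
  -- other reduces both to the equation for `∂_v F`. The boundary conditions follow from `F(x,0) = J
  -- Q(x) / 2`, which anticommutes with `J`.
  set k : ℝ × ℝ → 𝔸 := fun z => P (Function.uncurry F (L z)) + P' (Function.uncurry F (L' z))
    with hk
  have hkC : ContDiff ℝ 1 k := (P.contDiff.comp (hFC.comp L.contDiff)).add
    (P'.contDiff.comp (hFC.comp L'.contDiff))
  have hkd : ∀ z ∈ triangle b, fderivWithin ℝ k (triangle b) z =
      P.comp (((ContinuousLinearMap.fst ℝ ℝ ℝ).smulRight (F₁ (L z).1 (L z).2) +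
        (ContinuousLinearMap.snd ℝ ℝ ℝ).smulRight
          (J * Q ((L z).2 + (L z).1) * F (L z).2 (L z).1)).comp L) +
      P'.comp (((ContinuousLinearMap.fst ℝ ℝ ℝ).smulRight (F₁ (L' z).1 (L' z).2) +
        (ContinuousLinearMap.snd ℝ ℝ ℝ).smulRight
          (J * Q ((L' z).2 + (L' z).1) * F (L' z).2 (L' z).1)).comp L') := by
    intro z hz
    refine HasFDerivWithinAt.fderivWithin ?_ (uniqueDiffOn_triangle hb z hz)
    refine HasFDerivAt.hasFDerivWithinAt ?_
    exact (P.hasFDerivAt.comp z ((hFd (L z).1 (L z).2).comp z L.hasFDerivAt)).add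
      (P'.hasFDerivAt.comp z ((hFd (L' z).1 (L' z).2).comp z L'.hasFDerivAt))
  have hcurry : Function.uncurry (fun x t => k (x, t)) = k := rfl
  refine ⟨fun x t => k (x, t), hkC.contDiffOn, ?_, ?_, ?_⟩
  · rintro ⟨x, t⟩ hz
    rw [hcurry, hkd _ hz]
    simp only [hk, add_apply, ContinuousLinearMap.comp_apply,
      ContinuousLinearMap.smulRight_apply, ContinuousLinearMap.coe_fst', Function.uncurry_apply_pair,
      ContinuousLinearMap.coe_snd', hLv, hLv', hPv, hPv']
    rw [show 1 / 2 * (x - t) + 1 / 2 * (x + t) = x by ring,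
      show 1 / 2 * (x + t) + 1 / 2 * (x - t) = x by ring]
    generalize F₁ (1 / 2 * (x + t)) (1 / 2 * (x - t)) = p
    generalize F₁ (1 / 2 * (x - t)) (1 / 2 * (x + t)) = p'
    generalize F (1 / 2 * (x + t)) (1 / 2 * (x - t)) = f
    generalize F (1 / 2 * (x - t)) (1 / 2 * (x + t)) = f'
    simp only [mul_add, add_mul, mul_sub, sub_mul, mul_smul_comm, smul_mul_assoc, mul_assoc, hJJ,
      hJQ', hJ, mul_neg, neg_mul, mul_one, smul_add, smul_neg]
    module
  · intro x _
    simp only [hk, hLv, hLv', hPv, hPv', Function.uncurry_apply_pair]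
    rw [show (1 / 2 : ℝ) * (x + x) = x by ring, sub_self, mul_zero, hF0]
    generalize F 0 x = f
    simp only [mul_add, add_mul, mul_sub, sub_mul, mul_smul_comm, smul_mul_assoc, mul_assoc, hJJ,
      hJQ', hJQ, hJ, mul_neg, neg_mul, mul_one, smul_add, smul_neg, neg_neg]
    module
  · intro x _
    simp only [hk, hLv, hLv', hPv, hPv', Function.uncurry_apply_pair]
    rw [sub_neg_eq_add, show (1 / 2 : ℝ) * (x + x) = x by ring, add_neg_cancel, mul_zero, hF0]
    generalize F 0 x = f
    simp only [mul_add, add_mul, mul_sub, sub_mul, mul_smul_comm, smul_mul_assoc, mul_assoc, hJJ,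
      hJQ', hJQ, hJ, mul_neg, neg_mul, mul_one, smul_add, smul_neg, neg_neg]
    module

/-- Continuously differentiable functions on a closed interval extend to the line. -/
theorem exists_hasDerivAt_extension {E : Type*} [NormedAddCommGroup E] [NormedSpace ℝ E]
    [CompleteSpace E] {b : ℝ} (hb : 0 < b) {f : ℝ → E} (hf : ContDiffOn ℝ 1 f (Icc 0 b)) :
    ∃ g g' : ℝ → E, (∀ x, HasDerivAt g (g' x) x) ∧ Continuous g' ∧ EqOn g f (Icc 0 b) := by
  -- Extend the derivative by its endpoint values and integrate back.
  set d : ℝ → E := fun x => derivWithin f (Icc 0 b) (projIcc 0 b hb.le x) with hd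
  have hdc : Continuous d := (hf.continuousOn_derivWithin (uniqueDiffOn_Icc hb) le_rfl).comp_continuous
    (continuous_projIcc_val 0 b hb.le) fun x => Subtype.coe_prop _
  refine ⟨fun x => f 0 + ∫ t in (0 : ℝ)..x, d t, d,
    fun x => (hdc.integral_hasStrictDerivAt 0 x).hasDerivAt.const_add _, hdc, fun x hx => ?_⟩
  beta_reduce
  rw [intervalIntegral.integral_eq_sub_of_hasDerivAt_of_le (f := f) hx.1
    (hf.continuousOn.mono (Icc_subset_Icc_right hx.2)) (fun t ht => ?_)
    (hdc.intervalIntegrable _ _)]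
  · abel
  · have ht' : t ∈ Icc 0 b := ⟨ht.1.le, ht.2.le.trans hx.2⟩
    rw [hd]
    simp only [projIcc_of_mem hb.le ht']
    exact ((hf.differentiableOn one_ne_zero) t ht').hasDerivWithinAt.hasDerivAt
      (Icc_mem_nhds ht.1 (ht.2.trans_le hx.2))

end Existence

/-! ### The differences `P_{k+1} - P_{k-1}` behind the recursion. -/

section Polynomials

open Polynomial

/-- The Legendre polynomial `P_{k-1}`, where `P_{-1} = 1`. -/
noncomputable def legendrePred : ℕ → ℝ[X]
  | 0 => 1
  | k + 1 => legendreP k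

theorem eval_one_legendreP_sub_pred (k : ℕ) :
    eval 1 (legendreP (k + 1) - legendrePred k) = 0 := by
  cases k <;> simp [legendrePred, eval_legendreP_of_sq_eq_one]

theorem derivative_legendreP_sub_pred (k : ℕ) :
    derivative (legendreP (k + 1) - legendrePred k) = C (2 * (k : ℝ) + 1) * legendreP k := by
  cases k with
  | zero => simp [legendrePred, legendreP_one, legendreP_zero]
  | succ k =>
    rw [legendrePred, derivative_sub, derivative_legendreP_sub]
    push_cast
    ring_nf

/-- Bonnet's recurrence in disguise; for `k = 0` it forces `P_{-1} = 1`. -/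
theorem X_mul_derivative_legendreP_sub_pred (k : ℕ) :
    X * derivative (legendreP (k + 1) - legendrePred k) -
      C ((k : ℝ) + 1) * (legendreP (k + 1) - legendrePred k) =
      C (2 * (k : ℝ) + 1) * legendrePred k := by
  rw [derivative_legendreP_sub_pred]
  cases k with
  | zero => simp [legendrePred, legendreP_one, legendreP_zero]
  | succ k =>
    have h := legendreP_bonnet k
    simp only [map_add, map_mul, map_ofNat, map_one, Nat.cast_add, Nat.cast_one, map_natCast,
      legendrePred] at h ⊢
    linear_combination -h

end Polynomials

/-! ### Fourier–Legendre expansion, Neumann series and recursion for moments. -/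

section Expansion

theorem hasSum_even_sub_odd {E : Type*} [NormedAddCommGroup E] [NormedSpace ℂ E]
    [CompleteSpace E] {f e o : ℕ → E} {S : E} (h : HasSum f S)
    (he : ∀ n, f (2 * n) = (2 : ℂ) • e n) (ho : ∀ n, f (2 * n + 1) = (-2 : ℂ) • o n) :
    Summable e ∧ Summable o ∧ S = (2 : ℂ) • ∑' n, e n - (2 : ℂ) • ∑' n, o n := by
  have h1 := h.summable.comp_injective (i := fun n : ℕ => 2 * n)
    (mul_right_injective₀ (two_ne_zero' ℕ))
  have h2 := h.summable.comp_injective (i := fun n : ℕ => 2 * n + 1)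
    ((add_left_injective 1).comp (mul_right_injective₀ (two_ne_zero' ℕ)))
  have ht := tsum_even_add_odd h1 h2
  simp only [Function.comp_def, he] at h1
  simp only [Function.comp_def, ho] at h2
  simp only [he, ho] at ht
  have h1' : Summable e := by
    simpa [smul_smul] using h1.const_smul (2⁻¹ : ℂ)
  have h2' : Summable o := by
    simpa [smul_smul] using h2.const_smul ((-2)⁻¹ : ℂ)
  refine ⟨h1', h2', ?_⟩
  rw [← h.tsum_eq, ← ht, h1'.tsum_const_smul, h2'.tsum_const_smul, neg_smul, sub_eq_add_neg]

variable {𝔸 : Type*} [NormedRing 𝔸] [NormedAlgebra ℂ 𝔸]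

/-- The Fourier–Legendre coefficients of a kernel with values in a Banach algebra. -/
noncomputable def fourierLegendre (K : ℝ → ℝ → 𝔸) (n : ℕ) (x : ℝ) : 𝔸 :=
  ((2 * (n : ℝ) + 1) / 2) • ∫ t in (-x)..x, ((legendreP n).eval (t / x)) • K x t

/-- At `x = 0` both sides are zero, so the convention for `t / 0` plays no role. -/
theorem integral_eval_div_smul (R : Polynomial ℝ) (f : ℝ → 𝔸) (x : ℝ) :
    ∫ t in (-x)..x, R.eval (t / x) • f t = x • ∫ s in (-1 : ℝ)..1, R.eval s • f (x * s) := by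
  rw [integral_neg_self_eq fun t => R.eval (t / x) • f t]
  rcases eq_or_ne x 0 with rfl | hx
  · simp
  · rw [← intervalIntegral.integral_smul]
    simp only [mul_div_cancel_left₀ _ hx]

theorem fourierLegendre_eq (K : ℝ → ℝ → 𝔸) (n : ℕ) (x : ℝ) :
    fourierLegendre K n x = ((2 * (n : ℝ) + 1) / 2) • x • kernelMoment K (legendreP n) x := by
  rw [fourierLegendre, integral_eval_div_smul, kernelMoment]

variable {J : 𝔸} {b : ℝ} {Q : ℝ → 𝔸} {K : ℝ → ℝ → 𝔸}

theorem integral_freeSol_eq (lam : ℂ) (x : ℝ) :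
    ∫ t in (-x)..x, K x t * freeSol J lam t =
      x • ∫ s in (-1 : ℝ)..1, K x (x * s) * freeSol J (lam * x) s := by
  rw [integral_neg_self_eq fun t => K x t * freeSol J lam t, intervalIntegral.integral_smul]
  simp only [freeSol_mul_arg]

namespace IsGoursatKernel

theorem pow_smul_fourierLegendre_continuousOn (hK : IsGoursatKernel J b Q K) (n : ℕ) :
    ContinuousOn (fun x => x ^ n • fourierLegendre K n x) (Icc 0 b) := by
  simp only [fourierLegendre_eq]
  exact (continuous_pow n).continuousOn.smul
    ((continuousOn_id.smul (hK.continuousOn_kernelMoment _)).const_smul _)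

variable [CompleteSpace 𝔸]

theorem hasSum_moments (hK : IsGoursatKernel J b Q K) (lam : ℂ) {x : ℝ} (hx : x ∈ Icc 0 b) :
    HasSum (fun n : ℕ => fourierLegendre K n x *
        ∫ s in (-1 : ℝ)..1, (legendreP n).eval s • freeSol J (lam * x) s)
      (∫ t in (-x)..x, K x t * freeSol J lam t) := by
  have h := (hasSum_legendre_freeSol J ((hK.continuousOn_right hx).intervalIntegrable_of_Icc
    (by norm_num)) (lam * x)).const_smul x
  rw [integral_freeSol_eq]
  refine hasSum_of_eq h fun n => ?_
  rw [fourierLegendre_eq, kernelMoment]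
  simp only [smul_mul_assoc]
  rw [smul_comm]

theorem hasSum_fourierLegendre (hK : IsGoursatKernel J b Q K) (lam : ℂ) {x : ℝ}
    (hx : x ∈ Ioc 0 b) :
    HasSum (fun n : ℕ => (1 / x) • (fourierLegendre K n x *
        ∫ t in (-x)..x, (legendreP n).eval (t / x) • freeSol J lam t))
      (∫ t in (-x)..x, K x t * freeSol J lam t) := by
  refine hasSum_of_eq (hK.hasSum_moments lam ⟨hx.1.le, hx.2⟩) fun n => ?_
  rw [integral_eval_div_smul, mul_smul_comm, smul_smul, one_div_mul_cancel hx.1.ne', one_smul]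
  simp only [freeSol_mul_arg]

/-- The Neumann series of Bessel functions. -/
theorem neumann_series (hK : IsGoursatKernel J b Q K) (lam : ℂ) {x : ℝ} (hx : x ∈ Icc 0 b) :
    Summable (fun n : ℕ => ((-1) ^ n * sphBessel (2 * n) (lam * x)) •
      fourierLegendre K (2 * n) x) ∧
    Summable (fun n : ℕ => ((-1) ^ n * sphBessel (2 * n + 1) (lam * x)) •
      (fourierLegendre K (2 * n + 1) x * J)) ∧
    ∫ t in (-x)..x, K x t * freeSol J lam t =
      (2 : ℂ) • (∑' n : ℕ, ((-1) ^ n * sphBessel (2 * n) (lam * x)) •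
          fourierLegendre K (2 * n) x)
      - (2 : ℂ) • (∑' n : ℕ, ((-1) ^ n * sphBessel (2 * n + 1) (lam * x)) •
          (fourierLegendre K (2 * n + 1) x * J)) := by
  refine hasSum_even_sub_odd (hK.hasSum_moments lam hx) (fun n => ?_) fun n => ?_
  · rw [integral_legendreP_even_freeSol, mul_smul_comm, mul_one, mul_smul]
  · rw [integral_legendreP_odd_freeSol, mul_neg, mul_smul_comm, mul_smul, neg_smul]

/-- The recursion for the moments of a kernel. -/
theorem moment_recursion (hb : 0 < b) (hJ : J * J = -1) (hK : IsGoursatKernel J b Q K)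
    {V W : ℝ → 𝔸} (hV : IsSolution J b Q 0 V) (τ : 𝔸 →L[ℝ] 𝔸)
    (hτ : ∀ a c, τ (a * c) = τ c * τ a) (hτJ : τ J = -J) (hτQ : ∀ x, τ (Q x) = Q x)
    (hW : ∀ x ∈ Icc 0 b, W x = -(J * τ (V x) * J)) (hVW : ∀ x ∈ Icc 0 b, V x * W x = 1)
    (k : ℕ) {x : ℝ} (hx : x ∈ Icc 0 b) :
    x ^ (k + 1) • x • (kernelMoment K (legendreP (k + 1)) x - kernelMoment K (legendrePred k) x) =
      V x * ∫ t in (0 : ℝ)..x, W t * (-J) * (((2 * (k : ℝ) + 1) * t ^ (k + 1)) •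
        (kernelMoment K (legendreP k) t * J - J * kernelMoment K (legendrePred k) t)) := by
  have hH : ContinuousOn (fun t => ((2 * (k : ℝ) + 1) * t ^ (k + 1)) •
      (kernelMoment K (legendreP k) t * J - J * kernelMoment K (legendrePred k) t)) (Icc 0 b) :=
    (continuous_const.mul (continuous_pow (k + 1))).continuousOn.smul
      (((hK.continuousOn_kernelMoment _).mul continuousOn_const).sub
        (continuousOn_const.mul (hK.continuousOn_kernelMoment _)))
  rw [← hK.kernelMoment_sub _ _ hx]
  refine hV.variation_of_constants hJ τ hτ hτJ hτQ hW hVW hH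
    (Y := fun x => x ^ (k + 1) • x • kernelMoment K (legendreP (k + 1) - legendrePred k) x)
    (fun y hy => ?_) (by simp) hx
  exact hK.hasDerivWithinAt_pow_smul_kernelMoment hb hJ (eval_one_legendreP_sub_pred k)
    (derivative_legendreP_sub_pred k) (X_mul_derivative_legendreP_sub_pred k) hy

end IsGoursatKernel

end Expansion

/-! ### Specialization to `2 × 2` matrices and to `θ_n`. -/

section Matrices

theorem B_mul_B : B * B = -1 := by
  ext i j
  fin_cases i <;> fin_cases j <;> simp [B, Matrix.mul_apply]

theorem B_transpose : Bᵀ = -B := by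
  ext i j
  fin_cases i <;> fin_cases j <;> simp [B]

theorem B_mul_potential (p q : ℝ → ℂ) (x : ℝ) :
    B * potential p q x = -(potential p q x * B) := by
  ext i j
  fin_cases i <;> fin_cases j <;> simp [B, potential, Matrix.mul_apply]

theorem potential_transpose (p q : ℝ → ℂ) (x : ℝ) : (potential p q x)ᵀ = potential p q x := by
  ext i j
  fin_cases i <;> fin_cases j <;> simp [potential]

theorem U₀_eq (lam : ℂ) (x : ℝ) :
    U₀ lam x = Complex.cos (lam * x) • (1 : M2) - Complex.sin (lam * x) • B := by
  ext i j
  fin_cases i <;> fin_cases j <;> simp [B, U₀]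

theorem U₀_eq_freeSol (lam : ℂ) (x : ℝ) : U₀ lam x = freeSol B lam x := U₀_eq lam x

theorem IsTransmutationKernel.isGoursatKernel {b : ℝ} {Q : ℝ → M2} {K : ℝ → ℝ → M2}
    (h : IsTransmutationKernel b Q K) : IsGoursatKernel B b Q K :=
  ⟨h.contDiffOn, h.pde, h.diag, h.antidiag⟩

theorem IsFundamentalSolution.isSolution {b : ℝ} {Q : ℝ → M2} {U : ℂ → ℝ → M2}
    (h : IsFundamentalSolution b Q U) (lam : ℂ) : IsSolution B b Q lam (U lam) := by
  intro x hx
  have h1 := ((h lam).2.1 x hx).hasDerivWithinAt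
  have h2 := (h lam).2.2 x hx
  have e : derivWithin (U lam) (Icc 0 b) x =
      B * (Q x * U lam x) - lam • (B * U lam x) := by
    have h3 : B * (B * derivWithin (U lam) (Icc 0 b) x) = B * (lam • U lam x - Q x * U lam x) := by
      rw [← h2, add_sub_cancel_right]
    rw [← mul_assoc, B_mul_B, neg_one_mul, mul_sub, mul_smul_comm] at h3
    rw [← neg_neg (derivWithin (U lam) (Icc 0 b) x), h3, neg_sub]
  exact h1.congr_deriv e

theorem isFundamentalSolution_of_isSolution {b : ℝ} (hb : 0 < b) {Q : ℝ → M2} {U : ℂ → ℝ → M2}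
    (h0 : ∀ lam, U lam 0 = 1) (h : ∀ lam, IsSolution B b Q lam (U lam)) :
    IsFundamentalSolution b Q U := by
  refine fun lam => ⟨h0 lam, fun x hx => (h lam x hx).differentiableWithinAt, fun x hx => ?_⟩
  have e : derivWithin (U lam) (Icc 0 b) x = B * (Q x * U lam x) - lam • (B * U lam x) :=
    (h lam x hx).derivWithin (uniqueDiffOn_Icc hb x hx)
  rw [e, mul_sub, mul_smul_comm, ← mul_assoc B B, ← mul_assoc B B, B_mul_B, neg_one_mul,
    neg_one_mul, smul_neg, sub_neg_eq_add]
  abel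

theorem potential_eq (p q : ℝ → ℂ) (x : ℝ) :
    potential p q x = p x • (!![1, 0; 0, -1] : M2) + q x • (!![0, 1; 1, 0] : M2) := by
  ext i j
  fin_cases i <;> fin_cases j <;> simp [potential]

theorem continuousOn_potential {p q : ℝ → ℂ} {s : Set ℝ} (hp : ContinuousOn p s)
    (hq : ContinuousOn q s) : ContinuousOn (potential p q) s := by
  rw [funext (potential_eq p q)]
  exact (hp.smul continuousOn_const).add (hq.smul continuousOn_const)

theorem exists_isTransmutationKernel {b : ℝ} (hb : 0 < b) {p q : ℝ → ℂ}
    (hp : ContDiffOn ℝ 1 p (Icc 0 b)) (hq : ContDiffOn ℝ 1 q (Icc 0 b)) :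
    ∃ K : ℝ → ℝ → M2, IsTransmutationKernel b (potential p q) K := by
  obtain ⟨p', dp, hdp, hcp, ep⟩ := exists_hasDerivAt_extension hb hp
  obtain ⟨q', dq, hdq, hcq, eq⟩ := exists_hasDerivAt_extension hb hq
  have hQ : ∀ x, HasDerivAt (fun x => p' x • (!![1, 0; 0, -1] : M2) + q' x • (!![0, 1; 1, 0] : M2))
      (dp x • (!![1, 0; 0, -1] : M2) + dq x • (!![0, 1; 1, 0] : M2)) x := fun x =>
    ((hdp x).smul_const _).add ((hdq x).smul_const _)
  have hc : Continuous fun x => dp x • (!![1, 0; 0, -1] : M2) + dq x • (!![0, 1; 1, 0] : M2) :=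
    (hcp.smul continuous_const).add (hcq.smul continuous_const)
  obtain ⟨K, hK⟩ := exists_isGoursatKernel (𝔸 := M2) B_mul_B hb hQ hc fun x => by
    rw [← potential_eq]; exact B_mul_potential p' q' x
  have e : ∀ x ∈ Icc (0 : ℝ) b, p' x • (!![1, 0; 0, -1] : M2) + q' x • (!![0, 1; 1, 0] : M2) =
      potential p q x := by
    intro x hx
    rw [potential_eq, ep hx, eq hx]
  refine ⟨K, hK.contDiffOn, fun z hz => ?_, fun x hx => ?_, fun x hx => hK.antidiag x hx⟩
  · rw [← e z.1 ⟨hz.1, hz.2.1⟩]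
    exact hK.pde z hz
  · rw [← e x hx]
    exact hK.diag x hx

/-- Transposition as a continuous linear map. -/
noncomputable def transposeCLM : M2 →L[ℝ] M2 :=
  (Matrix.transposeLinearEquiv (Fin 2) (Fin 2) ℝ ℂ).toLinearMap.toContinuousLinearMap

theorem theta_natCast (K : ℝ → ℝ → M2) (k : ℕ) (x : ℝ) :
    theta K (k : ℤ) x = x ^ k • legendreCoeff K k x := by
  rw [theta, zpow_natCast]
  rfl

theorem legendreCoeff_eq (K : ℝ → ℝ → M2) (n : ℕ) (x : ℝ) :
    legendreCoeff K n x = ((2 * (n : ℝ) + 1) / 2 * x) • kernelMoment K (legendreP n) x := by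
  have h := fourierLegendre_eq K n x
  rw [smul_smul] at h
  exact h

theorem theta_natCast_eq_moment (K : ℝ → ℝ → M2) (k : ℕ) (x : ℝ) :
    theta K (k : ℤ) x = ((2 * (k : ℝ) + 1) / 2 * x ^ (k + 1)) • kernelMoment K (legendreP k) x := by
  rw [theta_natCast, legendreCoeff_eq, smul_smul]
  congr 1
  ring

/-- The factor `x` absorbs the `x⁻¹` in `θ_{-1}`, so the identity includes `x = 0`. For `k = 0` the
coefficient is `-1/2`, in agreement with `K_{-1} = -K_0` and `P_{-1} = P_0`. -/
theorem smul_theta_pred (K : ℝ → ℝ → M2) (k : ℕ) (x : ℝ) :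
    x • theta K ((k : ℤ) - 1) x =
      ((2 * (k : ℝ) - 1) / 2 * x ^ (k + 1)) • kernelMoment K (legendrePred k) x := by
  cases k with
  | zero =>
    have e : theta K (((0 : ℕ) : ℤ) - 1) x = x ^ (-1 : ℤ) • -legendreCoeff K 0 x := rfl
    rw [e, legendreCoeff_eq, legendreP_zero, ← neg_smul, smul_smul, smul_smul, legendrePred]
    congr 1
    rcases eq_or_ne x 0 with rfl | hx
    · simp
    · rw [zpow_neg_one]
      push_cast
      field_simp
      ring
  | succ k =>
    rw [show ((k + 1 : ℕ) : ℤ) - 1 = (k : ℤ) by push_cast; ring, theta_natCast_eq_moment,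
      smul_smul, legendrePred]
    congr 1
    push_cast
    ring

theorem involution_mul_eq_one {b : ℝ} {p q : ℝ → ℂ} {V : ℝ → M2}
    (hV : IsSolution B b (potential p q) 0 V) (hV0 : V 0 = 1) {x : ℝ} (hx : x ∈ Icc 0 b) :
    -(B * (V x)ᵀ * B) * V x = 1 :=
  hV.involution_mul (𝔸 := M2) B_mul_B hV0 transposeCLM (fun a c => Matrix.transpose_mul a c)
    Matrix.transpose_one B_transpose (potential_transpose p q) hx

theorem theta_recursion {b : ℝ} (hb : 0 < b) {p q : ℝ → ℂ} {V : ℝ → M2}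
    (hV : IsSolution B b (potential p q) 0 V) (hV0 : V 0 = 1) {K : ℝ → ℝ → M2}
    (hK : IsGoursatKernel B b (potential p q) K) (k : ℕ) {x : ℝ} (hx : x ∈ Icc 0 b) :
    theta K ((k + 1 : ℕ) : ℤ) x = ((2 * (k : ℝ) + 3) / (2 * (k : ℝ) - 1)) •
      (x ^ 2 • theta K ((k : ℤ) - 1) x + solOp V (fun t =>
        -(((2 * (k : ℝ) + 1) * t) • (B * theta K ((k : ℤ) - 1) t))
          + (2 * (k : ℝ) - 1) • (theta K (k : ℤ) t * B)) x) := by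
  have hk : (2 * (k : ℝ) - 1) ≠ 0 := by
    intro h
    have h' : 2 * k = 1 := by
      have : (2 * (k : ℝ)) = 1 := by linarith
      exact_mod_cast this
    omega
  have hinv : ∀ y ∈ Icc 0 b, (V y)⁻¹ = -(B * (V y)ᵀ * B) := fun y hy =>
    Matrix.inv_eq_left_inv (involution_mul_eq_one hV hV0 hy)
  -- The involution gives only a left inverse; for square matrices it is two-sided.
  have hVW : ∀ y ∈ Icc 0 b, V y * (V y)⁻¹ = 1 := fun y hy => by
    rw [hinv y hy]
    exact mul_eq_one_comm.1 (involution_mul_eq_one hV hV0 hy)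
  have h := hK.moment_recursion (𝔸 := M2) (W := fun y => (V y)⁻¹) hb B_mul_B hV transposeCLM
    (fun a c => Matrix.transpose_mul a c) B_transpose (potential_transpose p q) hinv hVW k hx
  have hH : ∀ t : ℝ, -(((2 * (k : ℝ) + 1) * t) • (B * theta K ((k : ℤ) - 1) t))
          + (2 * (k : ℝ) - 1) • (theta K (k : ℤ) t * B) =
      ((2 * (k : ℝ) - 1) / 2) • (((2 * (k : ℝ) + 1) * t ^ (k + 1)) •
        (kernelMoment K (legendreP k) t * B - B * kernelMoment K (legendrePred k) t)) := by
    intro t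
    rw [mul_smul, ← mul_smul_comm t, smul_theta_pred, theta_natCast_eq_moment, mul_smul_comm,
      smul_mul_assoc]
    module
  have hS : solOp V (fun t => -(((2 * (k : ℝ) + 1) * t) • (B * theta K ((k : ℤ) - 1) t))
          + (2 * (k : ℝ) - 1) • (theta K (k : ℤ) t * B)) x =
      ((2 * (k : ℝ) - 1) / 2) • (x ^ (k + 1) • x • (kernelMoment K (legendreP (k + 1)) x -
        kernelMoment K (legendrePred k) x)) := by
    rw [h, solOp]
    simp only [hH, B_transpose, mul_smul_comm]
    rw [intervalIntegral.integral_smul, mul_smul_comm]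
  rw [hS, pow_two, mul_smul x x, smul_theta_pred, theta_natCast_eq_moment]
  have e : (2 * ((k + 1 : ℕ) : ℝ) + 1) / 2 * x ^ (k + 1 + 1) =
      (2 * (k : ℝ) + 3) / (2 * (k : ℝ) - 1) * ((2 * (k : ℝ) - 1) / 2 * x ^ (k + 2)) := by
    push_cast
    field_simp
    ring
  rw [e, mul_smul]
  congr 1
  rw [smul_sub, smul_sub, smul_sub]
  module

end Matrices

end Dirac

theorem mainTheorem1 (b : ℝ) (hb : 0 < b) (p q : ℝ → ℂ)
    (hp : ContDiffOn ℝ 1 p (Icc 0 b)) (hq : ContDiffOn ℝ 1 q (Icc 0 b)) :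
    (∃ U : ℂ → ℝ → Dirac.M2, Dirac.IsFundamentalSolution b (Dirac.potential p q) U) ∧
    (∃ K : ℝ → ℝ → Dirac.M2, Dirac.IsTransmutationKernel b (Dirac.potential p q) K) ∧
    ∀ (U : ℂ → ℝ → Dirac.M2) (K : ℝ → ℝ → Dirac.M2),
      Dirac.IsFundamentalSolution b (Dirac.potential p q) U →
      Dirac.IsTransmutationKernel b (Dirac.potential p q) K →
      -- the transmutation property
      (∀ (lam : ℂ), ∀ x ∈ Icc (0 : ℝ) b,
        U lam x = Dirac.U₀ lam x + ∫ t in (-x)..x, K x t * Dirac.U₀ lam t) ∧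
      -- the representation before the integrals are evaluated
      (∀ (lam : ℂ), ∀ x ∈ Ioc (0 : ℝ) b,
        HasSum (fun n : ℕ => (1 / x) • (Dirac.legendreCoeff K n x *
            ∫ t in (-x)..x, ((Dirac.legendreP n).eval (t / x)) • Dirac.U₀ lam t))
          (U lam x - Dirac.U₀ lam x)) ∧
      -- the Neumann series of Bessel functions
      (∀ (lam : ℂ), ∀ x ∈ Icc (0 : ℝ) b,
        Summable (fun n : ℕ => ((-1) ^ n * Dirac.sphBessel (2 * n) (lam * x)) •
          Dirac.legendreCoeff K (2 * n) x) ∧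
        Summable (fun n : ℕ => ((-1) ^ n * Dirac.sphBessel (2 * n + 1) (lam * x)) •
          (Dirac.legendreCoeff K (2 * n + 1) x * Dirac.B)) ∧
        U lam x = Dirac.U₀ lam x
          + (2 : ℂ) • (∑' n : ℕ, ((-1) ^ n * Dirac.sphBessel (2 * n) (lam * x)) •
              Dirac.legendreCoeff K (2 * n) x)
          - (2 : ℂ) • (∑' n : ℕ, ((-1) ^ n * Dirac.sphBessel (2 * n + 1) (lam * x)) •
              (Dirac.legendreCoeff K (2 * n + 1) x * Dirac.B))) ∧
      -- the operator `S` and the functions it is applied to are well defined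
      (∀ x ∈ Icc (0 : ℝ) b, IsUnit (U 0 x)) ∧
      (∀ n : ℕ, ContinuousOn (Dirac.theta K n) (Icc 0 b)) ∧
      -- the recursive procedure
      (∀ x ∈ Icc (0 : ℝ) b, Dirac.theta K 0 x = Dirac.legendreCoeff K 0 x ∧
        Dirac.theta K 0 x = (1 / 2 : ℝ) • (U 0 x - 1)) ∧
      (∀ x ∈ Ioc (0 : ℝ) b, Dirac.theta K (-1) x = -((1 / x) • Dirac.legendreCoeff K 0 x) ∧
        Dirac.theta K (-1) x = -((1 / (2 * x)) • (U 0 x - 1))) ∧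
      (∀ n : ℤ, 1 ≤ n → ∀ x ∈ Icc (0 : ℝ) b,
        Dirac.theta K n x = ((2 * (n : ℝ) + 1) / (2 * (n : ℝ) - 3)) •
          (x ^ 2 • Dirac.theta K (n - 2) x
            + Dirac.solOp (U 0) (fun t =>
                -(((2 * (n : ℝ) - 1) * t) • (Dirac.B * Dirac.theta K (n - 2) t))
                  + (2 * (n : ℝ) - 3) • (Dirac.theta K (n - 1) t * Dirac.B)) x)) := by
  have hQ : ContinuousOn (Dirac.potential p q) (Icc 0 b) :=
    Dirac.continuousOn_potential hp.continuousOn hq.continuousOn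
  have hex := Dirac.exists_isTransmutationKernel hb hp hq
  refine ⟨?_, hex, ?_⟩
  -- The fundamental solution is obtained by transmuting the free one.
  · obtain ⟨K, hK⟩ := hex
    exact ⟨Dirac.transmuted Dirac.B K, Dirac.isFundamentalSolution_of_isSolution hb
      Dirac.transmuted_zero_right
      fun lam => hK.isGoursatKernel.isSolution_transmuted hb Dirac.B_mul_B lam⟩
  intro U K hU hK
  have hG := hK.isGoursatKernel
  have hS := hU.isSolution
  have hT : ∀ (lam : ℂ), ∀ x ∈ Icc (0 : ℝ) b,
      U lam x = Dirac.U₀ lam x + ∫ t in (-x)..x, K x t * Dirac.U₀ lam t := by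
    intro lam x hx
    have h := (hS lam).eqOn hQ (hG.isSolution_transmuted hb Dirac.B_mul_B lam)
      ((hU lam).1.trans (Dirac.transmuted_zero_right lam).symm) hx
    rw [h, Dirac.transmuted_eq]
    simp only [Dirac.U₀_eq_freeSol]
  -- The transmutation formula at `lam = 0`, where the free solution is the identity and `P_0 = 1`.
  have h0 : ∀ x ∈ Icc (0 : ℝ) b, Dirac.legendreCoeff K 0 x = (1 / 2 : ℝ) • (U 0 x - 1) := by
    intro x hx
    rw [hT 0 x hx, Dirac.legendreCoeff]
    simp [Dirac.U₀_eq, Dirac.legendreP_zero]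
  refine ⟨hT, fun lam x hx => ?_, fun lam x hx => ?_, fun x hx => ?_, fun n => ?_, fun x hx => ?_,
    fun x hx => ?_, fun n hn x hx => ?_⟩
  · rw [hT lam x ⟨hx.1.le, hx.2⟩, add_sub_cancel_left]
    simp only [Dirac.U₀_eq_freeSol]
    exact hG.hasSum_fourierLegendre lam hx
  · obtain ⟨h1, h2, h3⟩ := hG.neumann_series lam hx
    refine ⟨h1, h2, ?_⟩
    rw [hT lam x hx]
    simp only [Dirac.U₀_eq_freeSol]
    rw [add_sub_assoc]
    exact congrArg _ h3
  · have h := Dirac.involution_mul_eq_one (hS 0) (hU 0).1 hx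
    exact ⟨⟨U 0 x, _, mul_eq_one_comm.1 h, h⟩, rfl⟩
  · rw [funext (Dirac.theta_natCast K n)]
    exact hG.pow_smul_fourierLegendre_continuousOn n
  · have e : Dirac.theta K 0 x = Dirac.legendreCoeff K 0 x := by
      simpa using Dirac.theta_natCast K 0 x
    exact ⟨e, e.trans (h0 x hx)⟩
  · have e : Dirac.theta K (-1) x = -((1 / x) • Dirac.legendreCoeff K 0 x) := by
      have : Dirac.theta K (-1) x = x ^ (-1 : ℤ) • -Dirac.legendreCoeff K 0 x := rfl
      rw [this, zpow_neg_one, smul_neg, one_div]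
    refine ⟨e, ?_⟩
    rw [e, h0 x ⟨hx.1.le, hx.2⟩, smul_smul]
    congr 2
    rw [one_div_mul_one_div, mul_comm]
  · obtain ⟨k, rfl⟩ : ∃ k : ℕ, n = ((k + 1 : ℕ) : ℤ) := ⟨(n - 1).toNat, by omega⟩
    have h := Dirac.theta_recursion hb (hS 0) (hU 0).1 hG k hx
    have e1 : ((k + 1 : ℕ) : ℤ) - 2 = (k : ℤ) - 1 := by push_cast; ring
    have e2 : ((k + 1 : ℕ) : ℤ) - 1 = (k : ℤ) := by push_cast; ring
    have e3 : 2 * (((k + 1 : ℕ) : ℤ) : ℝ) + 1 = 2 * (k : ℝ) + 3 := by push_cast; ring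
    have e4 : 2 * (((k + 1 : ℕ) : ℤ) : ℝ) - 3 = 2 * (k : ℝ) - 1 := by push_cast; ring
    have e5 : 2 * (((k + 1 : ℕ) : ℤ) : ℝ) - 1 = 2 * (k : ℝ) + 1 := by push_cast; ring
    rw [e1, e2, e3, e4, e5]
    exact h
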